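/- Let $V$ be a finite-dimensional real Euclidean vector space with inner product $\langle\cdot,\cdot\rangle$, and let $\mathfrak R\subset V$ be an irreducible, reduced, crystallographic root system spanning $V$, with coroots $\alpha^\vee=2\alpha/\langle\alpha,\alpha\rangle$ $(\alpha\in\mathfrak R)$. Let $W$ be its Weyl group, i.e. the group generated by the reflections $x\mapsto x-\langle\alpha,x\rangle\alpha^\vee$, let $\Lambda\subset V$ be the coroot lattice, i.e. the additive group generated by all coroots, and let $W^{\mathrm{aff}}=\Lambda\rtimes W$ be the affine Weyl group, i.e. the group of all affine transformations $x\mapsto\lambda+w(x)$ of $V$ with $\lambda\in\Lambda$ and $w\in W$. Fix simple roots $\alpha_1,\dots,\alpha_l$, let $\alpha_{\max}$ be the corresponding highest root, and let $$A=\{x\in V \mid \langle\alpha_i,x\rangle>0 \text{ for } i=1,\dots,l,\ \text{and } \langle\alpha_{\max},x\rangle<1\}$$ be the open fundamental alcove. For $w\in W^{\mathrm{aff}}$ put $V_w=(\mathrm{id}-w)(A)=\{x-w(x)\mid x\in A\}$. Then the sets $V_w$, $w\in W^{\mathrm{aff}}$, are pairwise disjoint (that is, $V_w\cap V_{w'}=\emptyset$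 whenever $w\ne w'$), and $$V=\bigcup_{w\in W^{\mathrm{aff}}}V_w .$$ -/

import Mathlib

open scoped RealInnerProductSpace

namespace RootPairing

variable {ι V : Type*} [NormedAddCommGroup V] [InnerProductSpace ℝ V]

/-- A root pairing of a Euclidean space `V` with itself is Euclidean if the pairing is the inner
product and the coroot of a root `α` is `2 α / ⟪α, α⟫`. Roots and coroots are then both vectors
of `V`, and the reflection in a root `α` is the orthogonal reflection
`x ↦ x - ⟪α, x⟫ • (2 / ⟪α, α⟫) • α` in the hyperplane orthogonal to `α`. -/
class IsEuclidean (P : RootPairing ι ℝ V V) : Prop where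
  toLinearMap_apply : ∀ x y : V, P.toLinearMap x y = ⟪x, y⟫
  coroot_eq : ∀ i, P.coroot i = (2 / ⟪P.root i, P.root i⟫) • P.root i

/-- The action of the Weyl group on `V` preserves the coroot lattice (helper fact). -/
lemma smul_mem_corootSpan (P : RootPairing ι ℝ V V) [P.IsEuclidean] (w : P.weylGroup)
    {l : V} (hl : l ∈ P.corootSpan ℤ) : w • l ∈ P.corootSpan ℤ := by
  have key : ∀ (i : ι) (x : V), P.reflection i x = P.coreflection i x := by
    intro i x
    rw [reflection_apply, coreflection_apply]
    congr 1
    change P.toLinearMap x (P.coroot i) • _ = P.toLinearMap (P.root i) x • _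
    rw [IsEuclidean.toLinearMap_apply, IsEuclidean.toLinearMap_apply,
      IsEuclidean.coroot_eq (P := P), real_inner_smul_right, smul_smul,
      real_inner_comm x (P.root i), mul_comm]
  obtain ⟨g, hg⟩ := w
  change g • l ∈ _
  induction hg using weylGroup.induction generalizing l with
  | mem i =>
    rw [Equiv.reflection_smul, key]
    induction hl using Submodule.span_induction with
    | mem x hx =>
      obtain ⟨j, rfl⟩ := hx
      rw [← P.coroot_reflectionPerm]
      exact Submodule.subset_span ⟨_, rfl⟩
    | zero => simp
    | add x y _ _ hx hy => rw [map_add]; exact add_mem hx hy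
    | smul a x _ hx => rw [map_zsmul]; exact Submodule.smul_mem _ _ hx
  | one => simpa using hl
  | mul x y _ _ hx hy => rw [mul_smul]; exact hx (hy hl)

/-- The affine Weyl group `Λ ⋊ W`, as a group of affine transformations of `V`: the maps
`x ↦ l + w x` with `w` in the Weyl group `W` and `l` in the coroot lattice `Λ`, the additive
subgroup of `V` generated by the coroots. -/
def affineWeylGroup (P : RootPairing ι ℝ V V) [P.IsEuclidean] : Subgroup (V ≃ᵃ[ℝ] V) where
  carrier := {g | ∃ l ∈ P.corootSpan ℤ, ∃ w : P.weylGroup, ∀ x : V, g x = l + w • x}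
  one_mem' := ⟨0, zero_mem _, 1, fun x => by simp⟩
  mul_mem' := by
    rintro g h ⟨l, hl, w, hg⟩ ⟨m, hm, v, hh⟩
    refine ⟨l + w • m, add_mem hl (P.smul_mem_corootSpan w hm), w * v, fun x => ?_⟩
    rw [AffineEquiv.mul_def, AffineEquiv.trans_apply, hh, hg, smul_add, mul_smul, add_assoc]
  inv_mem' := by
    rintro g ⟨l, hl, w, hg⟩
    refine ⟨-(w⁻¹ • l), neg_mem (P.smul_mem_corootSpan w⁻¹ hl), w⁻¹, fun x => ?_⟩
    rw [AffineEquiv.inv_def, AffineEquiv.symm_apply_eq, hg, smul_add, smul_neg, smul_inv_smul,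
      smul_inv_smul, add_neg_cancel_left]

/-- The root with index `θ` is the highest root with respect to the base `b`: for each root `α`,
the difference `θ - α` is a sum of simple roots. -/
def Base.IsHighestRoot {P : RootPairing ι ℝ V V} (b : P.Base) (θ : ι) : Prop :=
  ∀ i, P.root θ - P.root i ∈ AddSubmonoid.closure (P.root '' b.support)

/-- The open fundamental alcove, cut out by the simple roots and by the root with index `θ`
(to be used for the highest root). -/
def Base.alcove {P : RootPairing ι ℝ V V} (b : P.Base) (θ : ι) : Set V :=
  {x | (∀ i ∈ b.support, 0 < ⟪P.root i, x⟫) ∧ ⟪P.root θ, x⟫ < 1}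

/-- The tile `(id - w)(A)` attached to an affine transformation `w`, where `A` is the open
fundamental alcove. -/
def Base.tile {P : RootPairing ι ℝ V V} (b : P.Base) (θ : ι) (w : V ≃ᵃ[ℝ] V) : Set V :=
  (fun x => x - w x) '' b.alcove θ

end RootPairing

/-! Both halves rest on one fact about the affine Weyl group: for `x`, `y` in the closed alcove,
`dist x y ≤ dist x (g y)`, strictly if both points are interior and `g ≠ 1`. It is proved by
induction on words in the wall reflections, using the exchange condition.

Disjointness: `x - g x = y - h y` means `g x - h y = x - y`, so `g⁻¹ h` carries `y` to a point at
the same distance from `x`; strictness forces `g = h`.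

Covering: let `f z` be the point of the closed alcove in the orbit of `z - v`. A fixed point `x` of
`f` in the open alcove solves `x - g x = v`. By the distance fact `f` is nonexpansive, so it has a
fixed point in the closed alcove; the difficulty is to find one off the walls. Orbits are discrete,
so near a fixed point `f` preserves the distance to it. Take `x` in the relative interior of the
convex set of fixed points, and suppose that it lies on a wall. Then `f` acts on a small piece of
sphere around `x`, inside the tangent cone and orthogonal to the fixed set. Pushing this piece
towards a suitable vector `c` of the cone perturbs `f` to strictly shrinking maps, so `f` has a
fixed point on the piece: a fixed direction orthogonal to all fixed directions, which is absurd. -/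

section FixedPoint
open Set Filter Topology Metric

/-! ### Fixed points of nonexpansive maps. -/

/-- Edelstein: a strictly shrinking self-map of a nonempty compact set has a fixed point. -/
theorem IsCompact.exists_fixedPoint_of_dist_lt {X : Type*} [MetricSpace X] {S : Set X}
    (hS : IsCompact S) (hne : S.Nonempty) {T : X → X} (hT : MapsTo T S S)
    (hlt : ∀ x ∈ S, ∀ y ∈ S, x ≠ y → dist (T x) (T y) < dist x y) : ∃ x ∈ S, T x = x := by
  have hc : ContinuousOn T S := by
    refine LipschitzOnWith.continuousOn (K := 1) (LipschitzOnWith.of_dist_le_mul ?_)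
    intro x hx y hy
    rcases eq_or_ne x y with rfl | h
    · simp
    · simpa using (hlt x hx y hy h).le
  -- At a point of least displacement, passing to `T x` would lower the displacement further unless
  -- `T x = x`.
  obtain ⟨x, hx, hmin⟩ := hS.exists_isMinOn hne (continuous_dist.comp_continuousOn (continuousOn_id.prodMk hc))
  refine ⟨x, hx, by_contra fun h => ?_⟩
  have h1 : dist x (T x) ≤ dist (T x) (T (T x)) := hmin (hT hx)
  exact absurd (hlt x hx (T x) (hT hx) (Ne.symm h)) (not_lt.2 h1)

/-- A continuous map on a compact set which is a uniform limit of strictly shrinking self-maps has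
a fixed point. -/
theorem IsCompact.exists_fixedPoint_of_approx {X : Type*} [MetricSpace X] {S : Set X}
    (hS : IsCompact S) (hne : S.Nonempty) {h : X → X} (hc : ContinuousOn h S)
    (happ : ∀ ε > 0, ∃ T : X → X, MapsTo T S S ∧
      (∀ x ∈ S, ∀ y ∈ S, x ≠ y → dist (T x) (T y) < dist x y) ∧ ∀ x ∈ S, dist (T x) (h x) ≤ ε) :
    ∃ x ∈ S, h x = x := by
  obtain ⟨x, hx, hmin⟩ := hS.exists_isMinOn hne (continuous_dist.comp_continuousOn (continuousOn_id.prodMk hc))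
  refine ⟨x, hx, by_contra fun hne' => ?_⟩
  have hpos : 0 < dist x (h x) := dist_pos.2 (Ne.symm hne')
  -- A fixed point of a map within half the least displacement of `h` would be displaced by `h` by
  -- at most that half.
  obtain ⟨T, hT, hlt, hclose⟩ := happ (dist x (h x) / 2) (by positivity)
  obtain ⟨y, hy, hfix⟩ := hS.exists_fixedPoint_of_dist_lt hne hT hlt
  have h1 : dist x (h x) ≤ dist y (h y) := hmin hy
  have h2 := hclose y hy
  rw [hfix] at h2
  linarith

variable {V : Type*} [NormedAddCommGroup V] [InnerProductSpace ℝ V]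

/-- Pushing two points of a sphere in a direction with which both have nonnegative inner product,
and projecting back to the sphere, strictly shrinks their distance. -/
theorem dist_normalize_add_lt {r : ℝ} (hr : 0 < r) {p q c : V} (hp : ‖p‖ = r) (hq : ‖q‖ = r)
    (hpc : 0 ≤ ⟪p, c⟫) (hqc : 0 ≤ ⟪q, c⟫) (hc : c ≠ 0) (hpq : p ≠ q) :
    dist ((r / ‖p + c‖) • (p + c)) ((r / ‖q + c‖) • (q + c)) < dist p q := by
  have hcc : 0 < ‖c‖ ^ 2 := by positivity
  have hP : ‖p + c‖ ^ 2 = r ^ 2 + 2 * ⟪p, c⟫ + ‖c‖ ^ 2 := by rw [norm_add_sq_real, hp]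
  have hQ : ‖q + c‖ ^ 2 = r ^ 2 + 2 * ⟪q, c⟫ + ‖c‖ ^ 2 := by rw [norm_add_sq_real, hq]
  have hPr : r < ‖p + c‖ := lt_of_pow_lt_pow_left₀ 2 (norm_nonneg _) (by linarith)
  have hQr : r < ‖q + c‖ := lt_of_pow_lt_pow_left₀ 2 (norm_nonneg _) (by linarith)
  have hPn : ‖(r / ‖p + c‖) • (p + c)‖ = r := by
    rw [norm_smul, Real.norm_eq_abs, abs_of_pos (div_pos hr (hr.trans hPr)),
      div_mul_cancel₀ _ (hr.trans hPr).ne']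
  have hQn : ‖(r / ‖q + c‖) • (q + c)‖ = r := by
    rw [norm_smul, Real.norm_eq_abs, abs_of_pos (div_pos hr (hr.trans hQr)),
      div_mul_cancel₀ _ (hr.trans hQr).ne']
  have hk : ⟪p, q⟫ < r ^ 2 := by
    have h1 : 0 < ‖p - q‖ ^ 2 := by
      have := norm_pos_iff.2 (sub_ne_zero.2 hpq)
      positivity
    rw [norm_sub_sq_real, hp, hq] at h1
    linarith
  set X := ⟪p, c⟫ + ⟪q, c⟫ + ‖c‖ ^ 2 with hX
  have hXpos : 0 < X := by positivity
  have hin : ⟪p + c, q + c⟫ = ⟪p, q⟫ + X := by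
    rw [inner_add_left, inner_add_right, inner_add_right, real_inner_comm q c,
      real_inner_self_eq_norm_sq]
    ring
  set D := ‖p + c‖ * ‖q + c‖ with hD
  have hD1 : r ^ 2 ≤ D := by rw [hD, sq]; gcongr
  have hD2 : D ≤ r ^ 2 + X := by
    have := sq_nonneg (‖p + c‖ - ‖q + c‖)
    rw [hD, hX]
    nlinarith
  have hDpos : 0 < D := lt_of_lt_of_le (by positivity) hD1
  -- All four vectors have norm `r`, so inner products decide. Of `r ^ 2 ≤ D ≤ r ^ 2 + X`, the upper
  -- bound serves when `⟪p, q⟫ ≥ 0` and the lower one when it is negative.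
  have key : ⟪p, q⟫ < ⟪(r / ‖p + c‖) • (p + c), (r / ‖q + c‖) • (q + c)⟫ := by
    rw [real_inner_smul_left, real_inner_smul_right, hin]
    have : r / ‖p + c‖ * (r / ‖q + c‖ * (⟪p, q⟫ + X)) = r ^ 2 * (⟪p, q⟫ + X) / D := by
      rw [hD]; field_simp
    rw [this, lt_div_iff₀ hDpos]
    rcases le_or_gt 0 ⟪p, q⟫ with h0 | h0
    · calc ⟪p, q⟫ * D ≤ ⟪p, q⟫ * (r ^ 2 + X) := by gcongr
        _ < r ^ 2 * (⟪p, q⟫ + X) := by nlinarith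
    · calc ⟪p, q⟫ * D ≤ ⟪p, q⟫ * r ^ 2 := by nlinarith
        _ < r ^ 2 * (⟪p, q⟫ + X) := by nlinarith [mul_pos (pow_pos hr 2) hXpos]
  rw [dist_eq_norm, dist_eq_norm]
  refine lt_of_pow_lt_pow_left₀ 2 (norm_nonneg _) ?_
  rw [norm_sub_sq_real, norm_sub_sq_real, hPn, hQn, hp, hq]
  linarith

/-- Adding `c` moves `p` by `‖c‖` and changes its norm by at most `‖c‖`, so projecting back costs at
most `‖c‖` more. -/
theorem dist_normalize_le {r : ℝ} {p c : V} (hp : ‖p‖ = r) (h : p + c ≠ 0) :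
    dist ((r / ‖p + c‖) • (p + c)) p ≤ 2 * ‖c‖ := by
  have h0 : 0 < ‖p + c‖ := norm_pos_iff.2 h
  have h1 : dist ((r / ‖p + c‖) • (p + c)) (p + c) ≤ ‖c‖ := by
    have : (r / ‖p + c‖) • (p + c) - (p + c) = (r / ‖p + c‖ - 1) • (p + c) := by
      rw [sub_smul, one_smul]
    rw [dist_eq_norm, this, norm_smul, Real.norm_eq_abs, ← abs_of_pos h0, ← abs_mul, abs_of_pos h0,
      sub_mul, div_mul_cancel₀ _ h0.ne', one_mul, ← hp]
    calc |‖p‖ - ‖p + c‖| ≤ ‖p - (p + c)‖ := abs_norm_sub_norm_le _ _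
      _ = ‖c‖ := by simp
  calc _ ≤ _ := dist_triangle _ (p + c) _
    _ ≤ ‖c‖ + ‖c‖ := by gcongr; simp [dist_eq_norm]
    _ = _ := by ring

/-- A nonexpansive self-map of a nonempty compact convex set has a fixed point. -/
theorem exists_fixedPoint_of_nonexpansive {K : Set V} (hK : IsCompact K) (hconv : Convex ℝ K)
    (hne : K.Nonempty) {f : V → V} (hf : MapsTo f K K)
    (hn : ∀ x ∈ K, ∀ y ∈ K, dist (f x) (f y) ≤ dist x y) : ∃ x ∈ K, f x = x := by
  obtain ⟨d, hd⟩ := hne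
  have hc : ContinuousOn f K :=
    LipschitzOnWith.continuousOn (K := 1)
      (LipschitzOnWith.of_dist_le_mul fun x hx y hy => by simpa using hn x hx y hy)
  refine hK.exists_fixedPoint_of_approx ⟨d, hd⟩ hc fun ε hε => ?_
  obtain ⟨R, hR⟩ := hK.isBounded.subset_closedBall d
  have hR0 : 0 ≤ R := by simpa using hR hd
  -- Contract `f` towards `d` by the factor `1 - t`: the bound `1 / 2` keeps this factor positive,
  -- and `R + 1` avoids division by zero.
  set t := min (1 / 2) (ε / (R + 1)) with ht
  have ht0 : 0 < t := lt_min (by norm_num) (by positivity)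
  have ht1 : t ≤ 1 / 2 := min_le_left _ _
  refine ⟨fun x => (1 - t) • f x + t • d, fun x hx => ?_, fun x hx y hy hxy => ?_, fun x hx => ?_⟩
  · exact hconv (hf hx) hd (by linarith) ht0.le (by ring)
  · have : dist ((1 - t) • f x + t • d) ((1 - t) • f y + t • d) = (1 - t) * dist (f x) (f y) := by
      rw [dist_add_right, dist_smul₀, Real.norm_eq_abs, abs_of_pos (by linarith)]
    rw [this]
    have h1 := hn x hx y hy
    have h2 : 0 < dist x y := dist_pos.2 hxy
    nlinarith
  · have : (1 - t) • f x + t • d - f x = t • (d - f x) := by module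
    rw [dist_eq_norm, this, norm_smul, Real.norm_eq_abs, abs_of_pos ht0]
    have h1 : ‖d - f x‖ ≤ R := by
      rw [← dist_eq_norm, dist_comm]; exact hR (hf hx)
    calc t * ‖d - f x‖ ≤ ε / (R + 1) * (R + 1) := by
          gcongr
          · exact min_le_right _ _
          · linarith
      _ = ε := by field_simp

/-- The fixed points of a nonexpansive self-map of a convex set form a convex set. -/
theorem convex_fixedPoints_of_nonexpansive {K : Set V} (hconv : Convex ℝ K) {f : V → V}
    (hn : ∀ x ∈ K, ∀ y ∈ K, dist (f x) (f y) ≤ dist x y) : Convex ℝ {x | x ∈ K ∧ f x = x} := by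
  rw [convex_iff_segment_subset]
  rintro x ⟨hx, hfx⟩ y ⟨hy, hfy⟩ z hz
  have hzK := hconv.segment_subset hx hy hz
  refine ⟨hzK, ?_⟩
  have h1 := hn x hx z hzK
  have h2 := hn z hzK y hy
  rw [hfx] at h1
  rw [hfy] at h2
  -- `f z` is no farther from `x` and `y` than `z` is, so the triangle inequality is tight and
  -- strict convexity of the norm gives `f z = z`.
  have h3 : dist x z + dist z y = dist x y := dist_add_dist_of_mem_segment hz
  have h4 := dist_triangle x (f z) y
  have e1 : dist x (f z) = dist x z := by linarith
  have e2 : dist (f z) y = dist z y := by linarith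
  rw [segment_eq_image_lineMap] at hz
  obtain ⟨t, ⟨ht0, ht1⟩, rfl⟩ := hz
  refine eq_lineMap_of_dist_eq_mul_of_dist_eq_mul ?_ ?_
  · rw [e1, dist_left_lineMap, Real.norm_eq_abs, abs_of_nonneg ht0]
  · rw [e2, dist_lineMap_right, Real.norm_eq_abs, abs_of_nonneg (by linarith)]

/-- A convex set in a finite-dimensional space has a point around which it fills its affine
span. -/
theorem Convex.exists_forall_vectorSpan [FiniteDimensional ℝ V] {F : Set V} (hF : Convex ℝ F)
    (hne : F.Nonempty) :
    ∃ x ∈ F, ∃ ε > 0, ∀ l ∈ vectorSpan ℝ F, ‖l‖ < ε → x + l ∈ F := by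
  obtain ⟨x, hx⟩ := hne.intrinsicInterior hF
  obtain ⟨⟨x, hxs⟩, hint, rfl⟩ := hx
  rw [mem_interior_iff_mem_nhds, Metric.mem_nhds_iff] at hint
  obtain ⟨ε, hε, hball⟩ := hint
  refine ⟨x, hball (mem_ball_self hε), ε, hε, fun l hl hlt => ?_⟩
  have hmem : x + l ∈ affineSpan ℝ F := by
    have := AffineSubspace.vadd_mem_of_mem_direction (s := affineSpan ℝ F)
      (by rwa [direction_affineSpan]) hxs
    rwa [vadd_eq_add, add_comm] at this
  have : (⟨x + l, hmem⟩ : affineSpan ℝ F) ∈ ball (⟨x, hxs⟩ : affineSpan ℝ F) ε := by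
    rw [mem_ball, Subtype.dist_eq]
    simpa [dist_eq_norm] using hlt
  exact hball this

/-- Let `T` be the closed polyhedral cone cut out by the vectors `a i`, `i ∈ s`. For each vector `e`
there is a vector of `T` whose inner products with the vectors of `T` are at least those of `e`. -/
theorem exists_mem_cone_inner_le [FiniteDimensional ℝ V] {J : Type*} (a : J → V) (s : Set J)
    (e : V) : ∃ c : V, (∀ i ∈ s, 0 ≤ ⟪a i, c⟫) ∧
      ∀ y : V, (∀ i ∈ s, 0 ≤ ⟪a i, y⟫) → ⟪e, y⟫ ≤ ⟪c, y⟫ := by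
  set T : Set V := {y | ∀ i ∈ s, 0 ≤ ⟪a i, y⟫} with hT
  have hclosed : IsClosed T := by
    have : T = ⋂ i ∈ s, {y | 0 ≤ ⟪a i, y⟫} := by ext; simp [hT]
    rw [this]
    exact isClosed_biInter fun i _ =>
      isClosed_le continuous_const (continuous_const.inner continuous_id)
  have hconv : Convex ℝ T := by
    intro x hx y hy p q hp hq _ i hi
    rw [inner_add_right, real_inner_smul_right, real_inner_smul_right]
    have := hx i hi
    have := hy i hi
    positivity
  have h0 : (0 : V) ∈ T := fun i _ => by simp
  obtain ⟨c, hcT, hc⟩ := exists_norm_eq_iInf_of_complete_convex ⟨0, h0⟩ hclosed.isComplete hconv e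
  rw [norm_eq_iInf_iff_real_inner_le_zero hconv hcT] at hc
  refine ⟨c, hcT, fun y hy => ?_⟩
  -- `c` is the point of the cone nearest to `e`; the cone is closed under addition, so `c + y` may
  -- be tested in the obtuse angle criterion.
  have h1 := hc (c + y) fun i hi => by
    rw [inner_add_right]
    exact add_nonneg (hcT i hi) (hy i hi)
  rw [add_sub_cancel_left, inner_sub_left] at h1
  linarith

/-! ### An interior fixed point in a polytope. -/

/-- A nonexpansive self-map of a full-dimensional polytope, which near each fixed point preserves the
distance to that point, has a fixed point in the interior. -/
theorem exists_interior_fixedPoint_of_polytope [FiniteDimensional ℝ V] {J : Type*} [Finite J]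
    (a : J → V) (b : J → ℝ) (hb : Bornology.IsBounded {x : V | ∀ j, b j ≤ ⟪a j, x⟫})
    {d : V} (hd : ∀ j, b j < ⟪a j, d⟫) {f : V → V}
    (hf : MapsTo f {x : V | ∀ j, b j ≤ ⟪a j, x⟫} {x : V | ∀ j, b j ≤ ⟪a j, x⟫})
    (hn : ∀ x ∈ {x : V | ∀ j, b j ≤ ⟪a j, x⟫}, ∀ y ∈ {x : V | ∀ j, b j ≤ ⟪a j, x⟫},
      dist (f x) (f y) ≤ dist x y)
    (hloc : ∀ x ∈ {x : V | ∀ j, b j ≤ ⟪a j, x⟫}, f x = x →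
      ∃ r > 0, ∀ y ∈ {x : V | ∀ j, b j ≤ ⟪a j, x⟫}, dist y x ≤ r → dist (f y) x = dist y x) :
    ∃ x, (∀ j, b j < ⟪a j, x⟫) ∧ f x = x := by
  set K : Set V := {x : V | ∀ j, b j ≤ ⟪a j, x⟫} with hKdef
  have hcl : IsClosed K := by
    have : K = ⋂ j, {x | b j ≤ ⟪a j, x⟫} := by ext; simp [hKdef]
    rw [this]
    exact isClosed_iInter fun j =>
      isClosed_le continuous_const (continuous_const.inner continuous_id)
  have hK : IsCompact K := isCompact_of_isClosed_isBounded hcl hb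
  have hconv : Convex ℝ K := by
    intro x hx y hy p q hp hq hpq j
    rw [inner_add_right, real_inner_smul_right, real_inner_smul_right]
    calc b j = p * b j + q * b j := by rw [← add_mul, hpq, one_mul]
      _ ≤ _ := by
        gcongr
        · exact hx j
        · exact hy j
  have hdK : d ∈ K := fun j => (hd j).le
  obtain ⟨x₀, hx₀⟩ := exists_fixedPoint_of_nonexpansive hK hconv ⟨d, hdK⟩ hf hn
  obtain ⟨x, ⟨hxK, hfx⟩, ε, hε, hL⟩ :=
    (convex_fixedPoints_of_nonexpansive hconv hn).exists_forall_vectorSpan ⟨x₀, hx₀⟩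
  set L := vectorSpan ℝ {x | x ∈ K ∧ f x = x} with hLdef
  refine ⟨x, fun j => lt_of_le_of_ne (hxK j) fun hj => ?_, hfx⟩
  set s : Set J := {i | b i = ⟪a i, x⟫} with hs
  -- The normal `a j` itself may leave the tangent cone at `x`. Its replacement `c` lies in the
  -- cone, has nonnegative product with the whole cone, and is nonzero because `a j` is positive on
  -- `d - x`.
  obtain ⟨c, hcT, hc⟩ := exists_mem_cone_inner_le a s (a j)
  have hKT : ∀ y ∈ K, ∀ i ∈ s, 0 ≤ ⟪a i, y - x⟫ := by
    intro y hy i hi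
    have h1 := hy i
    have h2 : b i = ⟪a i, x⟫ := hi
    rw [inner_sub_right]
    linarith
  have hcpos : ∀ y, (∀ i ∈ s, 0 ≤ ⟪a i, y⟫) → 0 ≤ ⟪y, c⟫ := fun y hy => by
    rw [real_inner_comm]
    exact (hy j hj).trans (hc y hy)
  have hc0 : c ≠ 0 := by
    rintro rfl
    have h1 := hc (d - x) (hKT d hdK)
    have h2 := hd j
    rw [inner_zero_left, inner_sub_right, ← hj] at h1
    linarith
  -- a small multiple of a vector of `L` can be added to `x` or subtracted from it
  have hsmall : ∀ l ∈ L, ∃ t : ℝ, 0 < t ∧ ∀ u : ℝ, |u| ≤ t → x + u • l ∈ K ∧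
      f (x + u • l) = x + u • l := by
    intro l hl
    refine ⟨ε / (‖l‖ + 1), by positivity, fun u hu => hL _ (L.smul_mem u hl) ?_⟩
    rw [norm_smul, Real.norm_eq_abs]
    calc |u| * ‖l‖ ≤ ε / (‖l‖ + 1) * ‖l‖ := by gcongr
      _ < ε / (‖l‖ + 1) * (‖l‖ + 1) := by gcongr; linarith
      _ = ε := by field_simp
  have hcL : ∀ l ∈ L, ⟪l, c⟫ = 0 := by
    intro l hl
    obtain ⟨t, ht, h⟩ := hsmall l hl
    have h1 := hcpos _ (hKT _ (h t (abs_of_pos ht).le).1)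
    have h2 := hcpos _ (hKT _ (h (-t) (by rw [abs_neg, abs_of_pos ht])).1)
    rw [add_sub_cancel_left, real_inner_smul_left] at h1 h2
    nlinarith
  obtain ⟨r₁, hr₁, hpres⟩ := hloc x hxK hfx
  have hnear : ∀ᶠ y in 𝓝 (0 : V), ∀ i, i ∉ s → b i ≤ ⟪a i, x + y⟫ := by
    rw [eventually_all]
    intro i
    by_cases hi : i ∈ s
    · exact Eventually.of_forall fun y h => absurd hi h
    · have hlt : b i < ⟪a i, x + 0⟫ := by
        rw [add_zero]
        exact lt_of_le_of_ne (hxK i) hi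
      have hcont : Continuous fun y : V => ⟪a i, x + y⟫ :=
        continuous_const.inner (continuous_const.add continuous_id)
      filter_upwards [hcont.continuousAt.eventually (lt_mem_nhds hlt)] with y hy _ using hy.le
  obtain ⟨r₂, hr₂, hball⟩ := Metric.eventually_nhds_iff.1 hnear
  -- Within `r₁`, `f` preserves the distance to `x`; within `r₂`, the constraints inactive at `x`
  -- still hold.
  set r := min r₁ (r₂ / 2) with hr
  have hr0 : 0 < r := lt_min hr₁ (by positivity)
  set S : Set V := {y | ‖y‖ = r ∧ (∀ l ∈ L, ⟪l, y⟫ = 0) ∧ ∀ i ∈ s, 0 ≤ ⟪a i, y⟫} with hS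
  have hSK : ∀ y ∈ S, x + y ∈ K := by
    rintro y ⟨hy, -, hyT⟩ i
    by_cases hi : i ∈ s
    · rw [inner_add_right, show b i = ⟪a i, x⟫ from hi]
      linarith [hyT i hi]
    · refine hball ?_ i hi
      rw [dist_zero_right, hy]
      exact (min_le_right _ _).trans_lt (by linarith)
  have hScl : IsCompact S := by
    refine isCompact_of_isClosed_isBounded ?_
      (isBounded_iff_forall_norm_le.2 ⟨r, fun y hy => hy.1.le⟩)
    have : S = {y | ‖y‖ = r} ∩ ((⋂ l ∈ L, {y | ⟪l, y⟫ = 0}) ∩ ⋂ i ∈ s, {y | 0 ≤ ⟪a i, y⟫}) := by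
      ext; simp [hS]
    rw [this]
    refine (isClosed_eq continuous_norm continuous_const).inter (IsClosed.inter ?_ ?_)
    · exact isClosed_biInter fun l _ =>
        isClosed_eq (continuous_const.inner continuous_id) continuous_const
    · exact isClosed_biInter fun i _ =>
        isClosed_le continuous_const (continuous_const.inner continuous_id)
  have hnorm : ∀ p : V, (∀ l ∈ L, ⟪l, p⟫ = 0) → (∀ i ∈ s, 0 ≤ ⟪a i, p⟫) → p ≠ 0 →
      (r / ‖p‖) • p ∈ S := by
    intro p hp1 hp2 hp0
    have hp : 0 < ‖p‖ := norm_pos_iff.2 hp0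
    refine ⟨?_, fun l hl => ?_, fun i hi => ?_⟩
    · rw [norm_smul, Real.norm_eq_abs, abs_of_pos (div_pos hr0 hp), div_mul_cancel₀ _ hp.ne']
    · rw [real_inner_smul_right, hp1 l hl, mul_zero]
    · rw [real_inner_smul_right]
      exact mul_nonneg (by positivity) (hp2 i hi)
  have hmaps : MapsTo (fun y => f (x + y) - x) S S := by
    intro y hy
    have hyK := hSK y hy
    have hnrm : ‖f (x + y) - x‖ = r := by
      have := hpres (x + y) hyK (by
        rw [dist_eq_norm, add_sub_cancel_left, hy.1]
        exact min_le_left _ _)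
      rw [dist_eq_norm, dist_eq_norm, add_sub_cancel_left, hy.1] at this
      exact this
    refine ⟨hnrm, ?_, hKT _ (hf hyK)⟩
    -- `x + u • l` is fixed for small `u`. In the squared inequality `‖f (x + y) - x - u • l‖ ≤ ‖y -
    -- u • l‖` only the cross term with `l` survives, and both signs of `u` make it vanish.
    have hle : ∀ l ∈ L, ∃ t : ℝ, 0 < t ∧ ∀ u : ℝ, |u| ≤ t →
        0 ≤ u * ⟪l, f (x + y) - x⟫ := by
      intro l hl
      obtain ⟨t, ht, h⟩ := hsmall l hl
      refine ⟨t, ht, fun u hu => ?_⟩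
      obtain ⟨h1, h2⟩ := h u hu
      have h3 := hn _ hyK _ h1
      rw [h2, dist_eq_norm, dist_eq_norm] at h3
      have e1 : f (x + y) - (x + u • l) = (f (x + y) - x) - u • l := by abel
      have e2 : x + y - (x + u • l) = y - u • l := by abel
      rw [e1, e2] at h3
      have h4 := pow_le_pow_left₀ (norm_nonneg _) h3 2
      rw [norm_sub_sq_real (f (x + y) - x), norm_sub_sq_real y, hnrm, hy.1, real_inner_smul_right,
        real_inner_smul_right, real_inner_comm l y, hy.2.1 l hl, real_inner_comm l] at h4
      linarith
    intro l hl
    obtain ⟨t, ht, h⟩ := hle l hl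
    have h1 := h t (abs_of_pos ht).le
    have h2 := h (-t) (by rw [abs_neg, abs_of_pos ht])
    nlinarith
  have hcont : ContinuousOn (fun y => f (x + y) - x) S := by
    refine LipschitzOnWith.continuousOn (K := 1) (LipschitzOnWith.of_dist_le_mul ?_)
    intro y hy z hz
    have := hn _ (hSK y hy) _ (hSK z hz)
    simpa using this
  have hSne : S.Nonempty := ⟨_, hnorm c hcL hcT hc0⟩
  obtain ⟨y, hyS, hyfix⟩ := hScl.exists_fixedPoint_of_approx hSne hcont fun δ hδ => by
    -- Chosen to match the bound `2 * ‖t • c‖` of `dist_normalize_le`.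
    set t := δ / (2 * ‖c‖) with ht
    have hcn : 0 < ‖c‖ := norm_pos_iff.2 hc0
    have ht0 : 0 < t := by positivity
    have htc0 : t • c ≠ 0 := smul_ne_zero ht0.ne' hc0
    have hin : ∀ p ∈ S, 0 ≤ ⟪p, t • c⟫ := fun p hp => by
      rw [real_inner_smul_right]
      exact mul_nonneg ht0.le (hcpos p hp.2.2)
    have hne0 : ∀ p ∈ S, p + t • c ≠ 0 := by
      intro p hp h0
      have h1 : ⟪p + t • c, t • c⟫ = 0 := by rw [h0, inner_zero_left]
      rw [inner_add_left] at h1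
      have h2 := real_inner_self_pos.2 htc0
      have h3 := hin p hp
      linarith
    refine ⟨fun y => (r / ‖f (x + y) - x + t • c‖) • (f (x + y) - x + t • c),
      fun y hy => ?_, fun y hy z hz hyz => ?_, fun y hy => ?_⟩
    · have hp := hmaps hy
      refine hnorm _ (fun l hl => ?_) (fun i hi => ?_) (hne0 _ hp)
      · rw [inner_add_right, hp.2.1 l hl, real_inner_smul_right, hcL l hl, mul_zero, add_zero]
      · rw [inner_add_right, real_inner_smul_right]
        exact add_nonneg (hp.2.2 i hi) (mul_nonneg ht0.le (hcT i hi))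
    · have hp := hmaps hy
      have hq := hmaps hz
      dsimp only at hp hq
      rcases eq_or_ne (f (x + y) - x) (f (x + z) - x) with h | h
      · simpa [h] using hyz
      · refine (dist_normalize_add_lt hr0 hp.1 hq.1 (hin _ hp) (hin _ hq) htc0 h).trans_le ?_
        simpa using hn _ (hSK y hy) _ (hSK z hz)
    · have hp := hmaps hy
      refine (dist_normalize_le hp.1 (hne0 _ hp)).trans ?_
      rw [norm_smul, Real.norm_eq_abs, abs_of_pos ht0, ht]
      apply le_of_eq
      field_simp
  have hyL : y ∈ L := by
    have h1 : x + y ∈ {x | x ∈ K ∧ f x = x} :=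
      ⟨hSK y hyS, by rw [add_comm x y]; rw [sub_eq_iff_eq_add, add_comm x y] at hyfix; exact hyfix⟩
    have := vsub_mem_vectorSpan ℝ h1 (show x ∈ {x | x ∈ K ∧ f x = x} from ⟨hxK, hfx⟩)
    simpa using this
  have h0 := hyS.2.1 y hyL
  rw [inner_self_eq_zero] at h0
  have := hyS.1
  rw [h0, norm_zero] at this
  exact hr0.ne this

end FixedPoint

/-! ### Affine reflection systems. -/

/-- A locally finite system of affine hyperplanes `⟪root ψ, x⟫ = level ψ` in a Euclidean space, stable
under the reflections in its members, together with a bounded chamber (the alcove), described by its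
walls. -/
structure AffineReflectionSystem (V κ J : Type*) [NormedAddCommGroup V] [InnerProductSpace ℝ V] where
  root : κ → V
  level : κ → ℝ
  root_ne_zero : ∀ ψ, root ψ ≠ 0
  reflection : κ → V ≃ᵃ[ℝ] V
  reflection_apply : ∀ ψ x, reflection ψ x =
    x - (2 * (⟪root ψ, x⟫ - level ψ) / ⟪root ψ, root ψ⟫) • root ψ
  exists_comp_reflection : ∀ φ ψ, ∃ χ, ∀ x,
    ⟪root χ, x⟫ - level χ = ⟪root ψ, reflection φ x⟫ - level ψ
  wall : J → κ
  base : V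
  base_mem : ∀ j, 0 < ⟪root (wall j), base⟫ - level (wall j)
  pos_or_neg : ∀ ψ,
    (∀ x, (∀ j, 0 < ⟪root (wall j), x⟫ - level (wall j)) → 0 < ⟪root ψ, x⟫ - level ψ) ∨
    (∀ x, (∀ j, 0 < ⟪root (wall j), x⟫ - level (wall j)) → ⟪root ψ, x⟫ - level ψ < 0)
  exists_facet : ∀ j, ∃ x, ⟪root (wall j), x⟫ - level (wall j) = 0 ∧
    ∀ i, i ≠ j → 0 < ⟪root (wall i), x⟫ - level (wall i)
  -- Makes the counting induction that reduces every reflection to wall reflections finite.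
  finite_base : ∀ R : ℝ,
    {ψ | 0 < ⟪root ψ, base⟫ - level ψ ∧ ⟪root ψ, base⟫ - level ψ < R}.Finite
  isBounded : Bornology.IsBounded {x | ∀ j, level (wall j) ≤ ⟪root (wall j), x⟫}
  finite_of_values : ∀ (x : V) (R : ℝ),
    {y | (∀ ψ, ∃ χ, ⟪root ψ, y⟫ - level ψ = ⟪root χ, x⟫ - level χ) ∧ ‖y‖ ≤ R}.Finite

namespace AffineReflectionSystem

open Set Filter Topology

variable {V κ J : Type*} [NormedAddCommGroup V] [InnerProductSpace ℝ V]
  (S : AffineReflectionSystem V κ J)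

/-- The affine functional vanishing on the hyperplane with index `ψ`. -/
def value (ψ : κ) (x : V) : ℝ := ⟪S.root ψ, x⟫ - S.level ψ

/-- The open alcove. -/
def alcove : Set V := {x | ∀ j, 0 < S.value (S.wall j) x}

/-- The closed alcove. -/
def closedAlcove : Set V := {x | ∀ j, 0 ≤ S.value (S.wall j) x}

/-- The group generated by the reflections. -/
def group : Subgroup (V ≃ᵃ[ℝ] V) := Subgroup.closure (range S.reflection)

lemma base_mem_alcove : S.base ∈ S.alcove := S.base_mem

lemma alcove_subset_closedAlcove : S.alcove ⊆ S.closedAlcove := fun _ hx j => (hx j).le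

lemma value_pos_or_neg (ψ : κ) :
    (∀ x ∈ S.alcove, 0 < S.value ψ x) ∨ (∀ x ∈ S.alcove, S.value ψ x < 0) := S.pos_or_neg ψ

lemma inner_root_self_pos (ψ : κ) : 0 < ⟪S.root ψ, S.root ψ⟫ :=
  real_inner_self_pos.2 (S.root_ne_zero ψ)

lemma value_add (ψ : κ) (x y : V) : S.value ψ (x + y) = S.value ψ x + ⟪S.root ψ, y⟫ := by
  rw [value, value, inner_add_right]
  ring

lemma value_lineMap (ψ : κ) (x y : V) (t : ℝ) :
    S.value ψ (x + t • (y - x)) = (1 - t) * S.value ψ x + t * S.value ψ y := by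
  rw [value_add, value, value, real_inner_smul_right, inner_sub_right]
  ring

lemma reflection_apply' (ψ : κ) (x : V) : S.reflection ψ x =
    x - (2 * S.value ψ x / ⟪S.root ψ, S.root ψ⟫) • S.root ψ := S.reflection_apply ψ x

lemma value_reflection (φ ψ : κ) (x : V) : S.value φ (S.reflection ψ x) =
    S.value φ x - 2 * S.value ψ x / ⟪S.root ψ, S.root ψ⟫ * ⟪S.root φ, S.root ψ⟫ := by
  rw [reflection_apply', sub_eq_add_neg, value_add, inner_neg_right, real_inner_smul_right]
  ring

lemma value_reflection_self (ψ : κ) (x : V) : S.value ψ (S.reflection ψ x) = -S.value ψ x := by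
  rw [value_reflection, div_mul_cancel₀ _ (S.inner_root_self_pos ψ).ne']
  ring

lemma reflection_reflection (ψ : κ) (x : V) : S.reflection ψ (S.reflection ψ x) = x := by
  rw [reflection_apply', value_reflection_self, reflection_apply']
  module

lemma reflection_mul_self (ψ : κ) : S.reflection ψ * S.reflection ψ = 1 := by
  ext x
  exact S.reflection_reflection ψ x

/-- Whether `y` or its mirror image is nearer to `x` depends only on whether `x` and `y` lie on the
same side. The comparisons of distances to orbit points rest on this. -/
lemma dist_reflection_right_sq (ψ : κ) (x y : V) : dist x (S.reflection ψ y) ^ 2 =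
    dist x y ^ 2 + 4 * S.value ψ x * S.value ψ y / ⟪S.root ψ, S.root ψ⟫ := by
  have h := (S.inner_root_self_pos ψ).ne'
  have e : x - S.reflection ψ y =
      (x - y) + (2 * S.value ψ y / ⟪S.root ψ, S.root ψ⟫) • S.root ψ := by
    rw [reflection_apply']
    abel
  have e2 : ⟪x - y, S.root ψ⟫ = S.value ψ x - S.value ψ y := by
    rw [real_inner_comm, value, value, inner_sub_right]
    ring
  rw [dist_eq_norm, dist_eq_norm, e, norm_add_sq_real, real_inner_smul_right, e2,
    ← real_inner_self_eq_norm_sq (_ • _), real_inner_smul_left, real_inner_smul_right]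
  field_simp
  ring

lemma dist_reflection (ψ : κ) (x y : V) :
    dist (S.reflection ψ x) (S.reflection ψ y) = dist x y := by
  have h1 := S.dist_reflection_right_sq ψ (S.reflection ψ x) y
  have h2 := S.dist_reflection_right_sq ψ y x
  rw [dist_comm y (S.reflection ψ x), dist_comm y x] at h2
  rw [value_reflection_self, h2] at h1
  rw [← sq_eq_sq₀ dist_nonneg dist_nonneg, h1]
  ring

lemma reflection_mem (ψ : κ) : S.reflection ψ ∈ S.group := Subgroup.subset_closure ⟨ψ, rfl⟩

lemma dist_map {g : V ≃ᵃ[ℝ] V} (hg : g ∈ S.group) (x y : V) : dist (g x) (g y) = dist x y := by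
  induction hg using Subgroup.closure_induction generalizing x y with
  | mem g hg =>
    obtain ⟨ψ, rfl⟩ := hg
    exact S.dist_reflection ψ x y
  | one => rfl
  | mul g h _ _ ihg ihh => exact (ihg _ _).trans (ihh _ _)
  | inv g _ ih =>
    rw [← ih (g⁻¹ x) (g⁻¹ y)]
    change dist (g (g.symm x)) (g (g.symm y)) = _
    simp

lemma exists_value_comp {g : V ≃ᵃ[ℝ] V} (hg : g ∈ S.group) (ψ : κ) :
    ∃ χ, ∀ x, S.value χ x = S.value ψ (g x) := by
  have hinv : ∀ x ∈ range S.reflection, x⁻¹ ∈ range S.reflection := by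
    rintro _ ⟨φ, rfl⟩
    exact ⟨φ, eq_inv_of_mul_eq_one_left (S.reflection_mul_self φ)⟩
  -- The generators are involutions, so the monoid closure suffices and no inverse case arises.
  have hg' : g ∈ Submonoid.closure (range S.reflection) := by
    have h := Subgroup.closure_toSubmonoid (range S.reflection)
    rw [union_eq_self_of_subset_right (fun x hx => by simpa using hinv _ hx)] at h
    rw [← h]
    exact hg
  clear hg
  induction hg' using Submonoid.closure_induction generalizing ψ with
  | mem g hg =>
    obtain ⟨φ, rfl⟩ := hg
    exact S.exists_comp_reflection φ ψ
  | one => exact ⟨ψ, fun x => rfl⟩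
  | mul g h _ _ ihg ihh =>
    obtain ⟨χ, hχ⟩ := ihg ψ
    obtain ⟨ω, hω⟩ := ihh χ
    exact ⟨ω, fun x => (hω x).trans (hχ (h x))⟩

/-- The group permutes the functionals, so their values at an orbit point all occur among their
values at `x`. -/
lemma finite_orbit (x : V) (R : ℝ) : {y | (∃ g ∈ S.group, g x = y) ∧ ‖y‖ ≤ R}.Finite := by
  refine (S.finite_of_values x R).subset ?_
  rintro _ ⟨⟨g, hg, rfl⟩, hR⟩
  exact ⟨fun ψ => (S.exists_value_comp hg ψ).imp fun χ hχ => (hχ x).symm, hR⟩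

lemma reflection_eq_of_smul {φ ψ : κ} {c : ℝ} (hr : S.root φ = c • S.root ψ)
    (hl : S.level φ = c * S.level ψ) : S.reflection φ = S.reflection ψ := by
  have hc : c ≠ 0 := by
    rintro rfl
    exact S.root_ne_zero φ (by simpa using hr)
  have h := (S.inner_root_self_pos ψ).ne'
  ext x
  rw [reflection_apply, reflection_apply, hr, hl, real_inner_smul_left, real_inner_smul_left,
    real_inner_smul_right, smul_smul]
  congr 2
  field_simp

lemma root_eq_smul_of_value {φ ψ : κ} {c : ℝ} (h : ∀ x, S.value φ x = c * S.value ψ x) :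
    S.root φ = c • S.root ψ ∧ S.level φ = c * S.level ψ := by
  have h0 : S.level φ = c * S.level ψ := by
    have := h 0
    simp only [value, inner_zero_right] at this
    linarith
  refine ⟨ext_inner_right ℝ fun v => ?_, h0⟩
  have := h v
  simp only [value] at this
  rw [real_inner_smul_left]
  linarith

lemma reflection_eq_of_value {φ ψ : κ} {c : ℝ} (h : ∀ x, S.value φ x = c * S.value ψ x) :
    S.reflection φ = S.reflection ψ :=
  S.reflection_eq_of_smul (S.root_eq_smul_of_value h).1 (S.root_eq_smul_of_value h).2

/-- Conjugation of reflections. -/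
lemma mul_reflection {g : V ≃ᵃ[ℝ] V} (hg : g ∈ S.group) {χ ψ : κ}
    (h : ∀ x, S.value χ x = S.value ψ (g x)) :
    g * S.reflection χ = S.reflection ψ * g := by
  have hlin : ∀ x v : V, g (x + v) = g x + g.linear v := fun x v => by
    have := g.map_vadd x v
    rwa [vadd_eq_add, vadd_eq_add, add_comm, add_comm _ (g x)] at this
  have hnorm : ∀ v : V, ‖g.linear v‖ = ‖v‖ := fun v => by
    have h1 := S.dist_map hg (0 + v) 0
    rw [hlin, dist_eq_norm, dist_eq_norm, add_sub_cancel_left] at h1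
    simpa using h1
  let e : V →ₗᵢ[ℝ] V := ⟨g.linear, hnorm⟩
  have hinner : ∀ u v : V, ⟪g.linear u, g.linear v⟫ = ⟪u, v⟫ := fun u v => e.inner_map_map u v
  have hroot : g.linear (S.root χ) = S.root ψ := by
    refine ext_inner_right ℝ fun w => ?_
    obtain ⟨v, rfl⟩ := g.linear.surjective w
    have h1 := h (0 + v)
    have h2 := h 0
    rw [hlin, value_add, value_add] at h1
    rw [hinner]
    linarith
  ext x
  rw [AffineEquiv.mul_def, AffineEquiv.mul_def, AffineEquiv.trans_apply, AffineEquiv.trans_apply,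
    reflection_apply', reflection_apply', sub_eq_add_neg, hlin, map_neg, map_smul, hroot, h,
    ← hinner, hroot, sub_eq_add_neg]

/-- The only hyperplane separating the alcove from its mirror image in a wall is that wall. -/
lemma reflection_eq_of_separates {ψ : κ} {j : J} (h₁ : 0 < S.value ψ S.base)
    (h₂ : S.value ψ (S.reflection (S.wall j) S.base) < 0) [Finite J] :
    S.reflection ψ = S.reflection (S.wall j) := by
  have hpos : ∀ x ∈ S.alcove, 0 < S.value ψ x := by
    rcases S.value_pos_or_neg ψ with h | h
    · exact h
    · exact absurd (h _ S.base_mem_alcove) h₁.not_gt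
  have hneg : ∀ x ∈ S.alcove, S.value ψ (S.reflection (S.wall j) x) < 0 := by
    obtain ⟨χ, hχ⟩ := S.exists_value_comp (S.reflection_mem (S.wall j)) ψ
    simp only [← hχ] at h₂ ⊢
    rcases S.value_pos_or_neg χ with h | h
    · exact absurd (h _ S.base_mem_alcove) h₂.not_gt
    · exact h
  obtain ⟨p, hp0, hp⟩ := S.exists_facet j
  set a := S.root (S.wall j) with ha
  have haa : 0 < ⟪a, a⟫ := S.inner_root_self_pos _
  set q := S.value ψ p with hq
  have hnear : ∀ᶠ v in 𝓝 (0 : V), ∀ i, i ≠ j → 0 < S.value (S.wall i) (p + v) := by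
    rw [eventually_all]
    intro i
    by_cases hi : i = j
    · exact Eventually.of_forall fun y h => absurd hi h
    · have hlt : 0 < S.value (S.wall i) (p + 0) := by
        rw [add_zero]
        exact hp i hi
      have hcont : Continuous fun y : V => S.value (S.wall i) (p + y) :=
        (continuous_const.inner (continuous_const.add continuous_id)).sub continuous_const
      filter_upwards [hcont.continuousAt.eventually (lt_mem_nhds hlt)] with y hy _ using hy
  -- From the facet point `p`, a short step along `v` enters the alcove. There `ψ` is positive while
  -- its reflected copy is negative; letting `t` tend to zero squeezes `ψ p` to zero.
  have hsmall : ∀ v : V, 0 < ⟪a, v⟫ → ∀ᶠ t in 𝓝[>] (0 : ℝ), 0 < q + t * ⟪S.root ψ, v⟫ ∧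
      q + t * ⟪S.root ψ, v⟫ < 2 * t * ⟪a, v⟫ / ⟪a, a⟫ * ⟪S.root ψ, a⟫ := by
    intro v hv
    have hcont : Tendsto (fun t : ℝ => t • v) (𝓝[>] 0) (𝓝 0) := by
      have : Continuous fun t : ℝ => t • v := continuous_id.smul continuous_const
      simpa using (this.tendsto 0).mono_left nhdsWithin_le_nhds
    filter_upwards [hcont.eventually hnear, self_mem_nhdsWithin] with t ht ht0
    have ht0' : 0 < t := ht0
    have hj : S.value (S.wall j) (p + t • v) = t * ⟪a, v⟫ := by
      rw [value_add, real_inner_smul_right, ← ha]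
      have : S.value (S.wall j) p = 0 := hp0
      rw [this, zero_add]
    have hmem : p + t • v ∈ S.alcove := by
      intro i
      by_cases hi : i = j
      · rw [hi, hj]
        positivity
      · exact ht i hi
    have e1 := hpos _ hmem
    have e2 := hneg _ hmem
    rw [value_reflection, hj] at e2
    rw [value_add, real_inner_smul_right] at e1 e2
    refine ⟨e1, ?_⟩
    rw [← mul_assoc] at e2
    linarith
  have hq0 : q = 0 := by
    have hlim1 : Tendsto (fun t : ℝ => q + t * ⟪S.root ψ, a⟫) (𝓝[>] 0) (𝓝 q) := by
      have : Continuous fun t : ℝ => q + t * ⟪S.root ψ, a⟫ := by fun_prop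
      simpa using (this.tendsto 0).mono_left nhdsWithin_le_nhds
    have hlim2 : Tendsto (fun t : ℝ => 2 * t * ⟪a, a⟫ / ⟪a, a⟫ * ⟪S.root ψ, a⟫) (𝓝[>] 0)
        (𝓝 0) := by
      have : Continuous fun t : ℝ => 2 * t * ⟪a, a⟫ / ⟪a, a⟫ * ⟪S.root ψ, a⟫ := by fun_prop
      simpa using (this.tendsto 0).mono_left nhdsWithin_le_nhds
    refine le_antisymm (le_of_tendsto_of_tendsto hlim1 hlim2 ?_) (ge_of_tendsto hlim1 ?_)
    · filter_upwards [hsmall a haa] with t ht using ht.2.le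
    · filter_upwards [hsmall a haa] with t ht using ht.1.le
  have hβ : ∀ v, 0 < ⟪a, v⟫ → 0 < ⟪S.root ψ, v⟫ := by
    intro v hv
    obtain ⟨t, ⟨h, -⟩, ht⟩ := ((hsmall v hv).and self_mem_nhdsWithin).exists
    have ht0 : 0 < t := ht
    rw [hq0, zero_add] at h
    exact (mul_pos_iff_of_pos_left ht0).1 h
  set c := ⟪S.root ψ, a⟫ / ⟪a, a⟫ with hc
  have hw : S.root ψ = c • a := by
    by_contra hne
    set w := S.root ψ - c • a with hw
    have hw0 : w ≠ 0 := sub_ne_zero.2 hne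
    have haw : ⟪a, w⟫ = 0 := by
      rw [hw, inner_sub_right, real_inner_smul_right, hc, div_mul_cancel₀ _ haa.ne',
        real_inner_comm, sub_self]
    have hβw : ⟪S.root ψ, w⟫ = ⟪w, w⟫ := by
      have : S.root ψ = w + c • a := by rw [hw]; abel
      rw [this, inner_add_left, real_inner_smul_left, haw]
      ring
    -- This vector is positive on `a` but orthogonal to `S.root ψ`.
    have h1 := hβ (a - (⟪S.root ψ, a⟫ / ⟪w, w⟫) • w) (by
      rw [inner_sub_right, real_inner_smul_right, haw]
      simpa using haa)
    rw [inner_sub_right, real_inner_smul_right, hβw,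
      div_mul_cancel₀ _ (real_inner_self_pos.2 hw0).ne'] at h1
    linarith
  refine S.reflection_eq_of_smul hw ?_
  have h1 : ⟪S.root ψ, p⟫ - S.level ψ = 0 := hq0
  have h2 : ⟪a, p⟫ - S.level (S.wall j) = 0 := hp0
  rw [hw, real_inner_smul_left] at h1
  rw [show S.level (S.wall j) = ⟪a, p⟫ by linarith]
  linarith

/-- The closed alcove being bounded, each root has positive inner product with a wall. -/
lemma exists_wall_inner_pos (ψ : κ) : ∃ j, 0 < ⟪S.root ψ, S.root (S.wall j)⟫ := by
  by_contra! hle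
  obtain ⟨R, hR⟩ := isBounded_iff_forall_norm_le.1 S.isBounded
  have hn : 0 < ‖S.root ψ‖ := norm_pos_iff.2 (S.root_ne_zero ψ)
  have hR0 : 0 ≤ R := (norm_nonneg _).trans (hR S.base fun j => by linarith [S.base_mem j])
  set t := (R + ‖S.base‖ + 1) / ‖S.root ψ‖ with ht
  have ht0 : 0 < t := by positivity
  -- Otherwise the ray from `S.base` along `-S.root ψ` would never leave the closed alcove; `t`
  -- takes it beyond the radius `R`.
  have h1 := hR (S.base - t • S.root ψ) fun j => by
    have h2 := S.base_mem j
    have h3 := hle j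
    rw [inner_sub_right, real_inner_smul_right, real_inner_comm (S.root ψ)]
    nlinarith
  have h4 : ‖t • S.root ψ‖ ≤ ‖S.base‖ + ‖S.base - t • S.root ψ‖ := by
    calc ‖t • S.root ψ‖ = ‖S.base - (S.base - t • S.root ψ)‖ := by rw [sub_sub_cancel]
      _ ≤ _ := norm_sub_le _ _
  rw [norm_smul, Real.norm_eq_abs, abs_of_pos ht0, ht, div_mul_cancel₀ _ hn.ne'] at h4
  linarith

/-- Reflecting in a wall with positive inner product lowers the value of `ψ` at the base point. If
it stays positive, fewer functionals lie below it and the reflection is a conjugate of one already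
treated; if it turns negative, the hyperplane is that wall. -/
lemma reflection_mem_closure_wall_of_pos [Finite J] (n : ℕ) : ∀ ψ : κ, 0 < S.value ψ S.base →
    {χ | 0 < S.value χ S.base ∧ S.value χ S.base < S.value ψ S.base}.ncard = n →
    S.reflection ψ ∈ Subgroup.closure (range fun j => S.reflection (S.wall j)) := by
  induction n using Nat.strong_induction_on with
  | _ n ih =>
  intro ψ hψ hn
  obtain ⟨j, hj⟩ := S.exists_wall_inner_pos ψ
  have hmem : S.reflection (S.wall j) ∈
      Subgroup.closure (range fun j => S.reflection (S.wall j)) :=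
    Subgroup.subset_closure ⟨j, rfl⟩
  obtain ⟨χ, hχ⟩ := S.exists_value_comp (S.reflection_mem (S.wall j)) ψ
  rcases S.value_pos_or_neg χ with h | h
  · have hpos := h _ S.base_mem_alcove
    have hlt : S.value χ S.base < S.value ψ S.base := by
      rw [hχ, value_reflection]
      have h1 : 0 < S.value (S.wall j) S.base := S.base_mem j
      have h2 := S.inner_root_self_pos (S.wall j)
      have : 0 < 2 * S.value (S.wall j) S.base / ⟪S.root (S.wall j), S.root (S.wall j)⟫ *
          ⟪S.root ψ, S.root (S.wall j)⟫ := by positivity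
      linarith
    have hcard : {ω | 0 < S.value ω S.base ∧ S.value ω S.base < S.value χ S.base}.ncard < n := by
      rw [← hn]
      refine ncard_lt_ncard ⟨fun ω hω => ⟨hω.1, hω.2.trans hlt⟩, fun hsub => ?_⟩
        (S.finite_base _)
      exact lt_irrefl _ (hsub (show χ ∈ _ from ⟨hpos, hlt⟩)).2
    have h3 := ih _ hcard χ hpos rfl
    have h4 := S.mul_reflection (S.reflection_mem (S.wall j)) hχ
    rw [← mul_inv_eq_iff_eq_mul] at h4
    rw [← h4]
    exact mul_mem (mul_mem hmem h3) (inv_mem hmem)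
  · have h1 := h _ S.base_mem_alcove
    rw [hχ] at h1
    rw [S.reflection_eq_of_separates hψ h1]
    exact hmem

lemma group_eq_closure_wall [Finite J] :
    S.group = Subgroup.closure (range fun j => S.reflection (S.wall j)) := by
  refine le_antisymm ((Subgroup.closure_le _).2 ?_) (Subgroup.closure_mono ?_)
  · rintro _ ⟨ψ, rfl⟩
    rcases S.value_pos_or_neg ψ with h | h
    · exact S.reflection_mem_closure_wall_of_pos _ ψ (h _ S.base_mem_alcove) rfl
    · obtain ⟨χ, hχ⟩ := S.exists_value_comp (S.reflection_mem ψ) ψ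
      have hχ' : ∀ x, S.value χ x = (-1) * S.value ψ x := fun x => by
        rw [hχ, value_reflection_self, neg_one_mul]
      rw [SetLike.mem_coe, ← S.reflection_eq_of_value hχ']
      refine S.reflection_mem_closure_wall_of_pos _ χ ?_ rfl
      have := h _ S.base_mem_alcove
      rw [hχ']
      linarith
  · rintro _ ⟨j, rfl⟩
    exact ⟨_, rfl⟩

/-! ### Words, the exchange condition and distances. -/

/-- The product of the reflections in the walls of a word. -/
def wordProd (l : List J) : V ≃ᵃ[ℝ] V := (l.map fun j => S.reflection (S.wall j)).prod

lemma wordProd_cons (j : J) (l : List J) :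
    S.wordProd (j :: l) = S.reflection (S.wall j) * S.wordProd l := by
  simp [wordProd]

lemma wordProd_mem (l : List J) : S.wordProd l ∈ S.group := by
  refine Subgroup.list_prod_mem _ fun g hg => ?_
  obtain ⟨j, -, rfl⟩ := List.mem_map.1 hg
  exact S.reflection_mem _

lemma exists_wordProd [Finite J] {g : V ≃ᵃ[ℝ] V} (hg : g ∈ S.group) :
    ∃ l, S.wordProd l = g := by
  rw [group_eq_closure_wall] at hg
  have hinv : ∀ j, (S.reflection (S.wall j))⁻¹ = S.reflection (S.wall j) := fun j =>
    (eq_inv_of_mul_eq_one_left (S.reflection_mul_self _)).symm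
  induction hg using Subgroup.closure_induction_left with
  | one => exact ⟨[], rfl⟩
  | mul_left x hx y _ ih =>
    obtain ⟨j, rfl⟩ := hx
    obtain ⟨l, rfl⟩ := ih
    exact ⟨j :: l, S.wordProd_cons j l⟩
  | inv_mul_cancel x hx y _ ih =>
    obtain ⟨j, rfl⟩ := hx
    obtain ⟨l, rfl⟩ := ih
    exact ⟨j :: l, by rw [S.wordProd_cons j l, hinv]⟩

/-- The exchange condition: if a wall separates the alcove from its image under a word, then
reflecting in that wall amounts to deleting a letter. -/
lemma exchange [Finite J] (l : List J) {j : J}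
    (h : S.value (S.wall j) (S.wordProd l S.base) < 0) :
    ∃ l' : List J, l'.length < l.length ∧
      S.reflection (S.wall j) * S.wordProd l = S.wordProd l' := by
  induction l using List.reverseRecOn with
  | nil => exact absurd h (S.base_mem j).not_gt
  | append_singleton l i ih =>
    have hprod : ∀ m : List J, S.wordProd (m ++ [i]) = S.wordProd m * S.reflection (S.wall i) :=
      fun m => by simp [wordProd]
    obtain ⟨χ, hχ⟩ := S.exists_value_comp (S.wordProd_mem l) (S.wall j)
    rcases S.value_pos_or_neg χ with hpos | hneg
    · have h1 := hpos _ S.base_mem_alcove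
      have h2 : S.value χ (S.reflection (S.wall i) S.base) < 0 := by
        rw [hχ]
        rw [hprod] at h
        exact h
      have h3 := S.mul_reflection (S.wordProd_mem l) hχ
      rw [S.reflection_eq_of_separates h1 h2] at h3
      refine ⟨l, by simp, ?_⟩
      rw [hprod, ← mul_assoc, ← h3, mul_assoc, reflection_mul_self, mul_one]
    · have h1 := hneg _ S.base_mem_alcove
      rw [hχ] at h1
      obtain ⟨l', hl', he⟩ := ih h1
      refine ⟨l' ++ [i], by simpa using hl', ?_⟩
      rw [hprod, hprod, ← mul_assoc, he]

lemma value_nonneg_of_mem_closedAlcove {ψ : κ} (h : ∀ x ∈ S.alcove, 0 < S.value ψ x) {y : V}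
    (hy : y ∈ S.closedAlcove) : 0 ≤ S.value ψ y := by
  have hlim : Tendsto (fun t : ℝ => (1 - t) * S.value ψ y + t * S.value ψ S.base) (𝓝[>] 0)
      (𝓝 (S.value ψ y)) := by
    have : Continuous fun t : ℝ => (1 - t) * S.value ψ y + t * S.value ψ S.base := by fun_prop
    simpa using (this.tendsto 0).mono_left nhdsWithin_le_nhds
  refine ge_of_tendsto hlim ?_
  filter_upwards [Ioo_mem_nhdsGT (zero_lt_one (α := ℝ))] with t ht
  rw [← value_lineMap]
  refine (h _ fun j => ?_).le
  rw [value_lineMap]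
  have h1 := hy j
  have h2 : 0 < S.value (S.wall j) S.base := S.base_mem j
  have h3 := mul_pos ht.1 h2
  have h4 := mul_nonneg (sub_nonneg.2 ht.2.le) h1
  linarith

/-- If the alcove and its image under `l` lie on the same side of wall `j`, the last reflection only
increases the distance from `x`. If not, `exchange` gives a shorter word for the same group element,
so the condition `≠ 1` carries over. -/
lemma dist_le_wordProd [Finite J] (n : ℕ) : ∀ l : List J, l.length = n →
    ∀ x ∈ S.closedAlcove, ∀ y ∈ S.closedAlcove, dist x y ≤ dist x (S.wordProd l y) ∧
      (S.wordProd l ≠ 1 → x ∈ S.alcove → y ∈ S.alcove → dist x y < dist x (S.wordProd l y)) := by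
  induction n using Nat.strong_induction_on with
  | _ n ih =>
  rintro (_ | ⟨j, l⟩) hl x hx y hy
  · exact ⟨le_rfl, fun h => absurd rfl h⟩
  obtain ⟨χ, hχ⟩ := S.exists_value_comp (S.wordProd_mem l) (S.wall j)
  rcases S.value_pos_or_neg χ with hpos | hneg
  · have h1 := (ih l.length (by simp [← hl]) l rfl x hx y hy).1
    have h2 := S.dist_reflection_right_sq (S.wall j) x (S.wordProd l y)
    have h3 := S.inner_root_self_pos (S.wall j)
    rw [wordProd_cons]
    change _ ≤ dist x (S.reflection (S.wall j) (S.wordProd l y)) ∧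
      (_ → _ → _ → _ < dist x (S.reflection (S.wall j) (S.wordProd l y)))
    constructor
    · refine h1.trans (le_of_sq_le_sq ?_ dist_nonneg)
      rw [h2]
      have h4 := hx j
      have h5 := S.value_nonneg_of_mem_closedAlcove hpos hy
      rw [hχ] at h5
      have : 0 ≤ 4 * S.value (S.wall j) x * S.value (S.wall j) (S.wordProd l y) /
        ⟪S.root (S.wall j), S.root (S.wall j)⟫ := by positivity
      linarith
    · intro _ hx' hy'
      refine h1.trans_lt (lt_of_pow_lt_pow_left₀ 2 dist_nonneg ?_)
      rw [h2]
      have h4 := hx' j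
      have h5 := hpos y hy'
      rw [hχ] at h5
      have : 0 < 4 * S.value (S.wall j) x * S.value (S.wall j) (S.wordProd l y) /
        ⟪S.root (S.wall j), S.root (S.wall j)⟫ := by positivity
      linarith
  · have h1 := hneg _ S.base_mem_alcove
    rw [hχ] at h1
    obtain ⟨l', hl', he⟩ := S.exchange l h1
    rw [wordProd_cons, he]
    refine ih l'.length ?_ l' rfl x hx y hy
    rw [← hl, List.length_cons]
    omega

/-- Among the points of the orbit of a point of the closed alcove, that point is the closest one to
each point of the closed alcove. -/
lemma dist_le_dist_map [Finite J] {g : V ≃ᵃ[ℝ] V} (hg : g ∈ S.group) {x y : V}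
    (hx : x ∈ S.closedAlcove) (hy : y ∈ S.closedAlcove) : dist x y ≤ dist x (g y) := by
  obtain ⟨l, rfl⟩ := S.exists_wordProd hg
  exact (S.dist_le_wordProd _ l rfl x hx y hy).1

lemma dist_lt_dist_map [Finite J] {g : V ≃ᵃ[ℝ] V} (hg : g ∈ S.group) (hg1 : g ≠ 1) {x y : V}
    (hx : x ∈ S.alcove) (hy : y ∈ S.alcove) : dist x y < dist x (g y) := by
  obtain ⟨l, rfl⟩ := S.exists_wordProd hg
  exact (S.dist_le_wordProd _ l rfl x (S.alcove_subset_closedAlcove hx) y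
    (S.alcove_subset_closedAlcove hy)).2 hg1 hx hy

/-- An orbit point nearest to the base point works: were it beyond a wall, reflecting it there would
bring it nearer. -/
lemma exists_map_mem_closedAlcove (z : V) : ∃ g ∈ S.group, g z ∈ S.closedAlcove := by
  set O : Set V := {y | (∃ g ∈ S.group, g z = y) ∧ dist S.base y ≤ dist S.base z} with hO
  have hfin : O.Finite := by
    refine (S.finite_orbit z (‖S.base‖ + dist S.base z)).subset fun y hy => ⟨hy.1, ?_⟩
    have h1 := hy.2
    calc ‖y‖ ≤ ‖S.base‖ + ‖y - S.base‖ := norm_le_norm_add_norm_sub' _ _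
      _ ≤ _ := by
        rw [← dist_eq_norm, dist_comm y]
        gcongr
  obtain ⟨y, ⟨⟨g, hg, rfl⟩, hy⟩, hmin⟩ :=
    exists_min_image O (dist S.base) hfin ⟨z, ⟨1, one_mem _, rfl⟩, le_rfl⟩
  refine ⟨g, hg, fun j => ?_⟩
  by_contra! hneg
  have h1 : dist S.base (S.reflection (S.wall j) (g z)) < dist S.base (g z) := by
    refine lt_of_pow_lt_pow_left₀ 2 dist_nonneg ?_
    rw [dist_reflection_right_sq]
    have h2 : 0 < S.value (S.wall j) S.base := S.base_mem j
    have h3 := S.inner_root_self_pos (S.wall j)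
    have : 4 * S.value (S.wall j) S.base * S.value (S.wall j) (g z) /
        ⟪S.root (S.wall j), S.root (S.wall j)⟫ < 0 :=
      div_neg_of_neg_of_pos (mul_neg_of_pos_of_neg (by positivity) hneg) h3
    linarith
  exact (hmin _ ⟨⟨S.reflection (S.wall j) * g, mul_mem (S.reflection_mem _) hg, rfl⟩,
    h1.le.trans hy⟩).not_gt h1

theorem eq_of_sub_map_eq_sub_map [Finite J] {g h : V ≃ᵃ[ℝ] V} (hg : g ∈ S.group)
    (hh : h ∈ S.group) {x y : V} (hx : x ∈ S.alcove) (hy : y ∈ S.alcove)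
    (he : x - g x = y - h y) : g = h := by
  by_contra hne
  have h1 := S.dist_lt_dist_map (mul_mem (inv_mem hg) hh)
    (fun h1 => hne (inv_mul_eq_one.1 h1)) hx hy
  have h2 : g ((g⁻¹ * h) y) = h y := by
    change (g * (g⁻¹ * h)) y = h y
    rw [mul_inv_cancel_left]
  rw [← S.dist_map hg x ((g⁻¹ * h) y), h2, dist_eq_norm, dist_eq_norm,
    sub_eq_sub_iff_sub_eq_sub.1 he] at h1
  exact lt_irrefl _ h1

theorem exists_sub_map_eq [Finite J] [FiniteDimensional ℝ V] (v : V) :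
    ∃ g ∈ S.group, ∃ x ∈ S.alcove, x - g x = v := by
  choose π hπ hπmem using fun z : V => S.exists_map_mem_closedAlcove (z - v)
  set K := {x : V | ∀ j, S.level (S.wall j) ≤ ⟪S.root (S.wall j), x⟫} with hK
  have hKmem : ∀ x, x ∈ K ↔ x ∈ S.closedAlcove := fun x =>
    forall_congr' fun j => sub_nonneg.symm
  -- Both points lie in the closed alcove, so applying `π x * (π y)⁻¹` to the second cannot bring it
  -- nearer to the first; it then becomes `π x (y - v)`.
  have hn : ∀ x y : V, dist (π x (x - v)) (π y (y - v)) ≤ dist x y := by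
    intro x y
    refine (S.dist_le_dist_map (mul_mem (hπ x) (inv_mem (hπ y))) (hπmem x) (hπmem y)).trans ?_
    have h1 : (π x * (π y)⁻¹) (π y (y - v)) = π x (y - v) := by
      change (π x * (π y)⁻¹ * π y) (y - v) = _
      rw [inv_mul_cancel_right]
    rw [h1, S.dist_map (hπ x)]
    simp
  obtain ⟨x, hx, hfix⟩ := exists_interior_fixedPoint_of_polytope
    (fun j => S.root (S.wall j)) (fun j => S.level (S.wall j)) S.isBounded (d := S.base)
    (fun j => sub_pos.1 (S.base_mem j)) (f := fun z => π z (z - v))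
    (fun z _ => (hKmem _).2 (hπmem z)) (fun x _ y _ => hn x y) fun x hxK hx => by
      -- the orbit of `x` is discrete
      set O : Set V := {y | (∃ g ∈ S.group, g x = y) ∧ ‖y‖ ≤ ‖x‖ + 1} with hO
      have hfin : (O \ {x}).Finite := (S.finite_orbit x (‖x‖ + 1)).subset sdiff_subset
      have hev : ∀ᶠ y in 𝓝 x, y ∉ O \ {x} :=
        hfin.isClosed.isOpen_compl.mem_nhds fun h => h.2 rfl
      obtain ⟨δ, hδ, hball⟩ := Metric.eventually_nhds_iff.1 hev
      -- The orbit point `π y (x - v)` is within `2 * dist y x` of `x`. This is less than `δ` and at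
      -- most `1`, so the point lies in `O` and must be `x`.
      refine ⟨min (δ / 3) (1 / 2), lt_min (by positivity) (by norm_num), fun y hy hyx => ?_⟩
      have hy1 : dist y x ≤ δ / 3 := hyx.trans (min_le_left _ _)
      have hy2 : dist y x ≤ 1 / 2 := hyx.trans (min_le_right _ _)
      have hd : dist (π y (x - v)) x ≤ 2 * dist y x := by
        calc dist (π y (x - v)) x ≤ dist (π y (x - v)) (π y (y - v)) + dist (π y (y - v)) x :=
              dist_triangle _ _ _
          _ ≤ dist y x + dist y x := by
            gcongr
            · rw [S.dist_map (hπ y)]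
              simp [dist_comm]
            · have := hn y x
              rwa [hx] at this
          _ = _ := by ring
      have heq : π y (x - v) = x := by
        by_contra hne
        refine hball (y := π y (x - v)) (by linarith) ⟨⟨⟨π y * (π x)⁻¹,
          mul_mem (hπ y) (inv_mem (hπ x)), ?_⟩, ?_⟩, hne⟩
        · calc (π y * (π x)⁻¹) x = (π y * (π x)⁻¹) (π x (x - v)) := by rw [hx]
            _ = (π y * (π x)⁻¹ * π x) (x - v) := rfl
            _ = _ := by rw [inv_mul_cancel_right]
        · calc ‖π y (x - v)‖ ≤ ‖x‖ + ‖π y (x - v) - x‖ := norm_le_norm_add_norm_sub' _ _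
            _ ≤ _ := by
              rw [← dist_eq_norm]
              gcongr
              linarith
      calc dist (π y (y - v)) x = dist (π y (y - v)) (π y (x - v)) := by rw [heq]
        _ = dist y x := by rw [S.dist_map (hπ y)]; simp
  refine ⟨(π x)⁻¹, inv_mem (hπ x), x, fun j => sub_pos.2 (hx j), ?_⟩
  have h1 : (π x)⁻¹ x = x - v := by
    calc (π x)⁻¹ x = (π x)⁻¹ (π x (x - v)) := by rw [hfix]
      _ = ((π x)⁻¹ * π x) (x - v) := rfl
      _ = _ := by rw [inv_mul_cancel]; rfl
  rw [h1, sub_sub_cancel]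

end AffineReflectionSystem

/-! ### The affine Weyl group of a Euclidean root system. -/

namespace RootPairing

open Set

variable {ι V : Type*} [NormedAddCommGroup V] [InnerProductSpace ℝ V]

lemma finite_setOf_abs_sub_intCast_le (c R : ℝ) : {m : ℤ | |c - m| ≤ R}.Finite := by
  refine (finite_Icc ⌈c - R⌉ ⌊c + R⌋).subset fun m hm => ?_
  obtain ⟨h1, h2⟩ := abs_le.1 (show |c - m| ≤ R from hm)
  exact ⟨Int.ceil_le.2 (by linarith), Int.le_floor.2 (by linarith)⟩

section

variable (P : RootPairing ι ℝ V V)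

lemma root_reflectionPerm_eq_sub (i j : ι) :
    P.root (P.reflectionPerm j i) = P.root i - P.pairing i j • P.root j := by
  rw [root_reflectionPerm, reflection_apply_root]

/-- The reflection in the affine hyperplane on which the root `α` takes the value `k`. -/
def affineReflection (i : ι) (k : ℤ) : V ≃ᵃ[ℝ] V :=
  (P.reflection i).toAffineEquiv.trans (AffineEquiv.constVAdd ℝ V ((k : ℝ) • P.coroot i))

lemma affineReflection_apply (i : ι) (k : ℤ) (x : V) :
    P.affineReflection i k x = (k : ℝ) • P.coroot i + P.reflection i x := rfl

lemma finite_setOf_inner_root_sub_lt [Finite ι] (x : V) (R : ℝ) :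
    {ψ : ι × ℤ | 0 < ⟪P.root ψ.1, x⟫ - ψ.2 ∧ ⟪P.root ψ.1, x⟫ - ψ.2 < R}.Finite := by
  refine (finite_iUnion fun i : ι => (finite_setOf_abs_sub_intCast_le
    ⟪P.root i, x⟫ R).image (Prod.mk i)).subset ?_
  rintro ⟨i, k⟩ ⟨h1, h2⟩
  exact mem_iUnion.2 ⟨i, k, (abs_of_pos h1).le.trans h2.le, rfl⟩

variable [P.IsRootSystem]

lemma eq_of_forall_inner_root_eq {x y : V} (h : ∀ i, ⟪P.root i, x⟫ = ⟪P.root i, y⟫) : x = y := by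
  refine ext_inner_left ℝ fun v => ?_
  have hv : v ∈ Submodule.span ℝ (range P.root) := by
    rw [IsRootSystem.span_root_eq_top]
    trivial
  induction hv using Submodule.span_induction with
  | mem v hv =>
    obtain ⟨i, rfl⟩ := hv
    exact h i
  | zero => simp
  | add u v _ _ hu hv => rw [inner_add_left, inner_add_left, hu, hv]
  | smul a v _ hv => rw [real_inner_smul_left, real_inner_smul_left, hv]

lemma isBounded_setOf_abs_inner_root_le [FiniteDimensional ℝ V] [Finite ι] (R : ℝ) :
    Bornology.IsBounded {x : V | ∀ i, |⟪P.root i, x⟫| ≤ R} := by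
  cases nonempty_fintype ι
  let f : V →ₗ[ℝ] ι → ℝ := LinearMap.pi fun i => (innerSL ℝ (P.root i)).toLinearMap
  have hf : LinearMap.ker f = ⊥ := by
    rw [LinearMap.ker_eq_bot]
    exact fun x y hxy => P.eq_of_forall_inner_root_eq fun i => congrFun hxy i
  obtain ⟨K, -, hK⟩ := LinearMap.exists_antilipschitzWith f hf
  refine (hK.isBounded_preimage (Metric.isBounded_closedBall (x := (0 : ι → ℝ)) (r := |R|))).subset
    fun x hx => ?_
  rw [mem_preimage, mem_closedBall_zero_iff, pi_norm_le_iff_of_nonneg (abs_nonneg R)]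
  exact fun i => (hx i).trans (le_abs_self R)

/-- Each `⟪P.root i, y⟫` is bounded and lies in finitely many cosets of the integers, and these
numbers determine `y` because the roots span. -/
lemma finite_setOf_inner_root_eq [Finite ι] (x : V) (R : ℝ) :
    {y : V | (∀ i, ∃ j, ∃ m : ℤ, ⟪P.root i, y⟫ = ⟪P.root j, x⟫ - m) ∧ ‖y‖ ≤ R}.Finite := by
  set F : ι → Set ℝ := fun i =>
    ⋃ j, (fun m : ℤ => ⟪P.root j, x⟫ - m) '' {m : ℤ | |⟪P.root j, x⟫ - m| ≤ ‖P.root i‖ * R} with hF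
  have hfin : ∀ i, (F i).Finite := fun i =>
    finite_iUnion fun j => (finite_setOf_abs_sub_intCast_le _ _).image _
  refine Finite.of_finite_image (f := fun (y : V) (i : ι) => ⟪P.root i, y⟫)
    ((Finite.pi' hfin).subset ?_)
    fun y _ z _ h => P.eq_of_forall_inner_root_eq fun i => congrFun h i
  rintro _ ⟨y, ⟨hy, hR⟩, rfl⟩ i
  obtain ⟨j, m, h⟩ := hy i
  refine mem_iUnion.2 ⟨j, m, ?_, h.symm⟩
  rw [mem_ofPred_eq, ← h]
  exact (abs_real_inner_le_norm _ _).trans (by gcongr)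

end

section Euclidean

variable (P : RootPairing ι ℝ V V) [P.IsEuclidean]

lemma inner_root_coroot (i j : ι) : ⟪P.root i, P.coroot j⟫ = P.pairing i j := by
  rw [← IsEuclidean.toLinearMap_apply (P := P), root_coroot_eq_pairing]

lemma reflection_apply_eq (i : ι) (x : V) :
    P.reflection i x = x - (2 * ⟪P.root i, x⟫ / ⟪P.root i, P.root i⟫) • P.root i := by
  rw [reflection_apply]
  change x - P.toLinearMap x (P.coroot i) • _ = _
  rw [IsEuclidean.toLinearMap_apply, IsEuclidean.coroot_eq, real_inner_smul_right,
    real_inner_comm x]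
  congr 2
  ring

lemma affineReflection_apply' (i : ι) (k : ℤ) (x : V) : P.affineReflection i k x =
    x - (2 * (⟪P.root i, x⟫ - k) / ⟪P.root i, P.root i⟫) • P.root i := by
  rw [affineReflection_apply, reflection_apply_eq, IsEuclidean.coroot_eq, smul_smul, mul_sub,
    sub_div]
  module

lemma exists_inner_affineReflection [P.IsCrystallographic] (i j : ι) (k m : ℤ) :
    ∃ n : ℤ, ∀ x, ⟪P.root (P.reflectionPerm j i), x⟫ - n =
      ⟪P.root i, P.affineReflection j m x⟫ - k := by
  obtain ⟨z, hz⟩ := P.exists_value (S := ℤ) i j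
  have hz' : P.pairing i j = z := by rw [← hz]; simp
  -- Integrality of the pairing keeps the reflected level an integer.
  refine ⟨k - m * z, fun x => ?_⟩
  have hc : 2 / ⟪P.root j, P.root j⟫ * ⟪P.root i, P.root j⟫ = z := by
    rw [← hz', ← P.inner_root_coroot, IsEuclidean.coroot_eq, real_inner_smul_right]
  rw [root_reflectionPerm_eq_sub, affineReflection_apply', inner_sub_left, inner_sub_right,
    real_inner_smul_left, real_inner_smul_right, hz']
  push_cast
  rw [← hc]
  ring

lemma affineReflection_mem (i : ι) (k : ℤ) : P.affineReflection i k ∈ P.affineWeylGroup := by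
  refine ⟨(k : ℝ) • P.coroot i, ?_, weylGroup.ofIdx P i, fun x => ?_⟩
  · rw [Int.cast_smul_eq_zsmul]
    exact Submodule.smul_mem _ _ (Submodule.subset_span ⟨i, rfl⟩)
  · rw [affineReflection_apply, weylGroup.ofIdx_smul, Equiv.reflection_smul]

/-- The affine Weyl group is generated by the affine reflections. -/
lemma closure_range_affineReflection :
    Subgroup.closure (range fun ψ : ι × ℤ => P.affineReflection ψ.1 ψ.2) = P.affineWeylGroup := by
  set G := Subgroup.closure (range fun ψ : ι × ℤ => P.affineReflection ψ.1 ψ.2) with hG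
  have hmem : ∀ i k, P.affineReflection i k ∈ G := fun i k =>
    Subgroup.subset_closure ⟨(i, k), rfl⟩
  refine le_antisymm ((Subgroup.closure_le _).2 ?_) ?_
  · rintro _ ⟨ψ, rfl⟩
    exact P.affineReflection_mem _ _
  rintro g ⟨l, hl, w, hg⟩
  have hw : ∃ h ∈ G, ∀ x : V, h x = w • x := by
    clear hg
    obtain ⟨w, hw⟩ := w
    change ∃ h ∈ G, ∀ x : V, h x = w • x
    induction hw using weylGroup.induction with
    | mem i =>
      refine ⟨_, hmem i 0, fun x => ?_⟩
      rw [affineReflection_apply, Equiv.reflection_smul]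
      simp
    | one => exact ⟨1, one_mem _, fun x => by simp⟩
    | mul x y _ _ hx hy =>
      obtain ⟨g, hg, hg'⟩ := hx
      obtain ⟨h, hh, hh'⟩ := hy
      refine ⟨g * h, mul_mem hg hh, fun x => ?_⟩
      rw [AffineEquiv.mul_def, AffineEquiv.trans_apply, hh', hg', mul_smul]
  let H : AddSubgroup V :=
    { carrier := {l | ∃ t ∈ G, ∀ x : V, t x = l + x}
      zero_mem' := ⟨1, one_mem _, fun x => by simp⟩
      add_mem' := by
        rintro a b ⟨s, hs, hs'⟩ ⟨t, ht, ht'⟩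
        exact ⟨s * t, mul_mem hs ht, fun x => by
          rw [AffineEquiv.mul_def, AffineEquiv.trans_apply, ht', hs', add_assoc]⟩
      neg_mem' := by
        rintro a ⟨s, hs, hs'⟩
        exact ⟨s⁻¹, inv_mem hs, fun x => by
          rw [AffineEquiv.inv_def, AffineEquiv.symm_apply_eq, hs', add_neg_cancel_left]⟩ }
  have hle : P.corootSpan ℤ ≤ AddSubgroup.toIntSubmodule H := by
    refine Submodule.span_le.2 ?_
    rintro _ ⟨i, rfl⟩
    -- Two reflections in parallel hyperplanes at levels `1` and `0` compose to the translation by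
    -- the coroot.
    refine ⟨P.affineReflection i 1 * P.affineReflection i 0, mul_mem (hmem i 1) (hmem i 0),
      fun x => ?_⟩
    rw [AffineEquiv.mul_def, AffineEquiv.trans_apply, affineReflection_apply,
      affineReflection_apply]
    simp
  obtain ⟨t, ht, ht'⟩ := hle hl
  obtain ⟨h, hh, hh'⟩ := hw
  have : g = t * h := by
    ext x
    rw [AffineEquiv.mul_def, AffineEquiv.trans_apply, ht', hh', hg]
  rw [this]
  exact mul_mem ht hh

end Euclidean

/-! ### The highest root and the fundamental alcove. -/

namespace Base

variable {P : RootPairing ι ℝ V V} (b : P.Base)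

lemma inner_nonneg_of_mem_closure {x y : V} (hx : ∀ i ∈ b.support, 0 ≤ ⟪P.root i, x⟫)
    (hy : y ∈ AddSubmonoid.closure (P.root '' b.support)) : 0 ≤ ⟪y, x⟫ := by
  induction hy using AddSubmonoid.closure_induction with
  | mem y hy =>
    obtain ⟨i, hi, rfl⟩ := hy
    exact hx i hi
  | zero => simp
  | add y z _ _ hy hz =>
    rw [inner_add_left]
    exact add_nonneg hy hz

lemma inner_pos_of_mem_closure {x y : V} (hx : ∀ i ∈ b.support, 0 < ⟪P.root i, x⟫)
    (hy : y ∈ AddSubmonoid.closure (P.root '' b.support)) (hy0 : y ≠ 0) : 0 < ⟪y, x⟫ := by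
  suffices y = 0 ∨ 0 < ⟪y, x⟫ from this.resolve_left hy0
  clear hy0
  induction hy using AddSubmonoid.closure_induction with
  | mem y hy =>
    obtain ⟨i, hi, rfl⟩ := hy
    exact Or.inr (hx i hi)
  | zero => exact Or.inl rfl
  | add y z _ _ hy hz =>
    rw [inner_add_left]
    rcases hy with rfl | hy <;> rcases hz with rfl | hz
    · simp
    · simpa using Or.inr hz
    · simpa using Or.inr hy
    · exact Or.inr (add_pos hy hz)

lemma exists_inner_eq [FiniteDimensional ℝ V] [P.IsRootSystem] (c : ι → ℝ) :
    ∃ x : V, ∀ i ∈ b.support, ⟪P.root i, x⟫ = c i := by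
  let f : V →ₗ[ℝ] ℝ := b.toWeightBasis.constr ℝ fun i => c i
  refine ⟨(InnerProductSpace.toDual ℝ V).symm (LinearMap.toContinuousLinearMap f), fun i hi => ?_⟩
  rw [real_inner_comm, InnerProductSpace.toDual_symm_apply]
  have := b.toWeightBasis.constr_basis ℝ (fun i : b.support => c i) ⟨i, hi⟩
  rwa [toWeightBasis_apply] at this

namespace IsHighestRoot

variable {b} {θ : ι} (hθ : b.IsHighestRoot θ)

include hθ

/-- The maximality of `θ` is applied to the root `-P.root i`, whose index is `P.reflectionPerm i i`.
-/
lemma add_root_mem (i : ι) :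
    P.root θ + P.root i ∈ AddSubmonoid.closure (P.root '' b.support) := by
  have h := hθ (P.reflectionPerm i i)
  rwa [root_reflectionPerm, reflection_apply_self, sub_neg_eq_add] at h

lemma inner_nonneg {x : V} (hx : ∀ i ∈ b.support, 0 ≤ ⟪P.root i, x⟫) : 0 ≤ ⟪P.root θ, x⟫ := by
  have := b.inner_nonneg_of_mem_closure hx (hθ.add_root_mem θ)
  rw [inner_add_left] at this
  linarith

lemma inner_pos {x : V} (hx : ∀ i ∈ b.support, 0 < ⟪P.root i, x⟫) : 0 < ⟪P.root θ, x⟫ := by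
  have h0 : P.root θ + P.root θ ≠ 0 := by
    rw [← two_smul ℝ]
    exact smul_ne_zero two_ne_zero (P.ne_zero θ)
  have := b.inner_pos_of_mem_closure hx (hθ.add_root_mem θ) h0
  rw [inner_add_left] at this
  linarith

lemma abs_inner_root_le {x : V} (hx : ∀ i ∈ b.support, 0 ≤ ⟪P.root i, x⟫) (i : ι) :
    |⟪P.root i, x⟫| ≤ ⟪P.root θ, x⟫ := by
  have h1 := b.inner_nonneg_of_mem_closure hx (hθ i)
  have h2 := b.inner_nonneg_of_mem_closure hx (hθ.add_root_mem i)
  rw [inner_sub_left] at h1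
  rw [inner_add_left] at h2
  exact abs_le.2 ⟨by linarith, by linarith⟩

lemma exists_inner_eq_smul [FiniteDimensional ℝ V] [P.IsRootSystem] {c : ι → ℝ}
    (hc : ∀ i, 0 ≤ c i) : ∃ x : V, ∃ t > 0, (∀ i ∈ b.support, ⟪P.root i, x⟫ = t * c i) ∧
      ⟪P.root θ, x⟫ < 1 := by
  obtain ⟨u, hu⟩ := b.exists_inner_eq c
  have h0 : 0 ≤ ⟪P.root θ, u⟫ := hθ.inner_nonneg fun i hi => (hu i hi).symm ▸ hc i
  refine ⟨(⟪P.root θ, u⟫ + 1)⁻¹ • u, (⟪P.root θ, u⟫ + 1)⁻¹, by positivity, fun i hi => ?_, ?_⟩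
  · rw [real_inner_smul_right, hu i hi]
  · rw [real_inner_smul_right, inv_mul_lt_one₀ (by positivity)]
    linarith

/-- On the alcove each root has constant sign and absolute value below `1`, so it never crosses an
integer level. -/
lemma inner_sub_intCast_pos_or_neg (i : ι) (k : ℤ) :
    (∀ x ∈ b.alcove θ, 0 < ⟪P.root i, x⟫ - k) ∨ (∀ x ∈ b.alcove θ, ⟪P.root i, x⟫ - k < 0) := by
  have hlt : ∀ x ∈ b.alcove θ, |⟪P.root i, x⟫| < 1 := fun x hx =>
    (hθ.abs_inner_root_le (fun i hi => (hx.1 i hi).le) i).trans_lt hx.2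
  rcases b.root_mem_or_neg_mem i with h | h
  · have hpos : ∀ x ∈ b.alcove θ, 0 < ⟪P.root i, x⟫ := fun x hx =>
      b.inner_pos_of_mem_closure hx.1 h (P.ne_zero i)
    rcases le_or_gt k 0 with hk | hk
    · have hk' : (k : ℝ) ≤ 0 := by exact_mod_cast hk
      exact Or.inl fun x hx => by linarith [hpos x hx]
    · have hk' : (1 : ℝ) ≤ k := by exact_mod_cast hk
      exact Or.inr fun x hx => by linarith [(abs_lt.1 (hlt x hx)).2]
  · have hneg : ∀ x ∈ b.alcove θ, ⟪P.root i, x⟫ < 0 := fun x hx => by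
      have := b.inner_pos_of_mem_closure hx.1 h (neg_ne_zero.2 (P.ne_zero i))
      rw [inner_neg_left] at this
      linarith
    rcases lt_or_ge k 0 with hk | hk
    · have hk' : (k : ℝ) ≤ -1 := by exact_mod_cast Int.le_sub_one_of_lt hk
      exact Or.inl fun x hx => by linarith [(abs_lt.1 (hlt x hx)).1]
    · have hk' : (0 : ℝ) ≤ k := by exact_mod_cast hk
      exact Or.inr fun x hx => by linarith [hneg x hx]

end IsHighestRoot

/-- The indices of the hyperplanes bounding the fundamental alcove. -/
def alcoveWall (θ : ι) : Option b.support → ι × ℤ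
  -- The root `-θ` at level `-1`, so that the functional is `1 - θ`, positive on the alcove.
  | none => (P.reflectionPerm θ θ, -1)
  | some i => (i, 0)

lemma forall_alcoveWall_iff {θ : ι} {x : V} {p : ℝ → Prop} :
    (∀ j, p (⟪P.root (b.alcoveWall θ j).1, x⟫ - (b.alcoveWall θ j).2)) ↔
      (∀ i ∈ b.support, p ⟪P.root i, x⟫) ∧ p (1 - ⟪P.root θ, x⟫) := by
  rw [Option.forall, and_comm]
  refine and_congr ?_ (iff_of_eq (congrArg p ?_))
  · simp [alcoveWall]
  · simp only [alcoveWall, root_reflectionPerm, reflection_apply_self, inner_neg_left]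
    push_cast
    ring

lemma mem_alcove_iff {θ : ι} {x : V} : x ∈ b.alcove θ ↔
    ∀ j, 0 < ⟪P.root (b.alcoveWall θ j).1, x⟫ - (b.alcoveWall θ j).2 := by
  rw [b.forall_alcoveWall_iff (p := fun t => 0 < t), sub_pos]
  rfl

/-- The affine reflections of a Euclidean root system, with its fundamental alcove. -/
noncomputable def affineReflectionSystem [FiniteDimensional ℝ V] [Finite ι] [P.IsEuclidean]
    [P.IsRootSystem] [P.IsCrystallographic] {θ : ι} (hθ : b.IsHighestRoot θ) :
    AffineReflectionSystem V (ι × ℤ) (Option b.support) where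
  root ψ := P.root ψ.1
  level ψ := ψ.2
  root_ne_zero ψ := P.ne_zero ψ.1
  reflection ψ := P.affineReflection ψ.1 ψ.2
  reflection_apply ψ x := P.affineReflection_apply' ψ.1 ψ.2 x
  exists_comp_reflection φ ψ := by
    obtain ⟨n, hn⟩ := P.exists_inner_affineReflection ψ.1 φ.1 ψ.2 φ.2
    exact ⟨(P.reflectionPerm φ.1 ψ.1, n), hn⟩
  wall := b.alcoveWall θ
  base := (hθ.exists_inner_eq_smul (c := fun _ => 1) fun _ => zero_le_one).choose
  base_mem := by
    obtain ⟨t, ht, h1, h2⟩ :=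
      (hθ.exists_inner_eq_smul (c := fun _ => 1) fun _ => zero_le_one).choose_spec
    refine b.mem_alcove_iff.1 ⟨fun i hi => ?_, h2⟩
    rw [h1 i hi, mul_one]
    exact ht
  pos_or_neg ψ := by
    simp only [← b.mem_alcove_iff]
    exact hθ.inner_sub_intCast_pos_or_neg ψ.1 ψ.2
  exists_facet := by
    classical
    rintro (_ | j)
    · obtain ⟨u, hu⟩ := b.exists_inner_eq fun _ => 1
      have hpos : 0 < ⟪P.root θ, u⟫ := hθ.inner_pos fun i hi => by rw [hu i hi]; exact one_pos
      -- Scaled to put `u`, where all simple roots are positive, on the wall `θ = 1`.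
      refine ⟨⟪P.root θ, u⟫⁻¹ • u, ?_, ?_⟩
      · simp [alcoveWall, root_reflectionPerm, real_inner_smul_right, hpos.ne']
      · rintro (_ | i) hi
        · exact absurd rfl hi
        · simp [alcoveWall, real_inner_smul_right, hu i i.2, hpos]
    · obtain ⟨x, t, ht, h1, h2⟩ := hθ.exists_inner_eq_smul
        (c := fun i => if i = j then 0 else 1) fun i => by split_ifs <;> norm_num
      refine ⟨x, by simp [alcoveWall, h1 j j.2], ?_⟩
      rintro (_ | i) hi
      · simp only [alcoveWall, root_reflectionPerm, reflection_apply_self, inner_neg_left]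
        push_cast
        linarith
      · have hij : (i : ι) ≠ j := fun h => hi (by rw [Subtype.ext h])
        simp [alcoveWall, h1 i i.2, hij, ht]
  finite_base R := P.finite_setOf_inner_root_sub_lt _ R
  isBounded := by
    refine (P.isBounded_setOf_abs_inner_root_le 1).subset fun x hx i => ?_
    have h := (b.forall_alcoveWall_iff (θ := θ) (x := x) (p := fun t => 0 ≤ t)).1
      fun j => sub_nonneg.2 (hx j)
    exact (hθ.abs_inner_root_le h.1 i).trans (by linarith [h.2])
  finite_of_values x R := by
    refine (P.finite_setOf_inner_root_eq x R).subset fun y hy => ⟨fun i => ?_, hy.2⟩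
    obtain ⟨χ, hχ⟩ := hy.1 (i, 0)
    exact ⟨χ.1, χ.2, by simpa using hχ⟩

end Base

end RootPairing

theorem theorem2 {V : Type*} [NormedAddCommGroup V] [InnerProductSpace ℝ V]
    [FiniteDimensional ℝ V] {ι : Type*} [Finite ι]
    (P : RootPairing ι ℝ V V) [P.IsEuclidean] [P.IsRootSystem] [P.IsCrystallographic]
    [P.IsReduced] [P.IsIrreducible]
    (b : P.Base) (θ : ι) (hθ : b.IsHighestRoot θ) :
    Pairwise (fun w w' : P.affineWeylGroup => Disjoint (b.tile θ w) (b.tile θ w')) ∧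
      (⋃ w : P.affineWeylGroup, b.tile θ w) = Set.univ := by
  set S := b.affineReflectionSystem hθ with hS
  have hgroup : S.group = P.affineWeylGroup := P.closure_range_affineReflection
  have halcove : ∀ x, x ∈ S.alcove ↔ x ∈ b.alcove θ := fun x => b.mem_alcove_iff.symm
  constructor
  · intro w w' hne
    rw [Set.disjoint_left]
    rintro _ ⟨x, hx, rfl⟩ ⟨y, hy, he⟩
    refine hne (Subtype.ext (S.eq_of_sub_map_eq_sub_map (hgroup.ge w.2) (hgroup.ge w'.2)
      ((halcove x).2 hx) ((halcove y).2 hy) he.symm))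
  · refine Set.eq_univ_of_forall fun v => ?_
    obtain ⟨g, hg, x, hx, he⟩ := S.exists_sub_map_eq v
    exact Set.mem_iUnion.2 ⟨⟨g, hgroup.le hg⟩, x, (halcove x).1 hx, he⟩
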